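/- Let $M$ be a closed smooth $n$-manifold, $E\to M$ a smooth complex vector bundle of rank $r$, $\mu$ a finite Borel measure on $M$ that is positive on non-empty open sets (for instance the Riemannian volume measure of a Riemannian metric on $M$), and $\alpha:M\to\mathbb R$ a smooth function with $r\alpha>-1$. Let $\Gamma(Herm(E))$ be the real vector space of smooth families $v=(v_x)_{x\in M}$ of Hermitian sesquilinear forms on the fibres of $E$, with the smooth compact-open topology, and let $\Gamma(Herm^+(E))$ be the subset of those which are positive definite on every fibre (the smooth Hermitian metrics on $E$). For $h\in\Gamma(Herm^+(E))$ and $v\in\Gamma(Herm(E))$ let $h^{-1}v$ be the endomorphism of $E$ with $v(a,b)=h(a,(h^{-1}v)b)$. Equip $\Gamma(Herm^+(E))$ with the weak Riemannian metric $$(v,w)_h=\int_M \bigl(\mathrm{tr}(h^{-1}v\,h^{-1}w)+\alpha\,\mathrm{tr}(h^{-1}v)\,\mathrm{tr}(h^{-1}w)\bigr)\,d\mu .$$ A geodesic $\gamma:\mathbb R\to\Gamma(Herm^+(E))$ of this metric is a smooth curve such that, for every $t$ and every $l\in\Gamma(Herm(E))$, $$(\ddot\gamma(t),l)_{\gamma(t)}=\tfrac12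 D(\dot\gamma(t),\dot\gamma(t))_{\gamma(t)}(l)-D(\dot\gamma(t),l)_{\gamma(t)}(\dot\gamma(t)),$$ where $D(v,w)_h(k)$ denotes the derivative of $h\mapsto(v,w)_h$ at $h$ in the direction $k$. Let $h\in\Gamma(Herm^+(E))$. Then for every $v\in\Gamma(Herm(E))$ there is exactly one geodesic $\gamma_v:\mathbb R\to\Gamma(Herm^+(E))$ with $\gamma_v(0)=h$ and $\dot\gamma_v(0)=v$, and the exponential map $Exp_h(v)=\gamma_v(1)$ is given pointwise by $Exp_h(v)=h\,e^{h^{-1}v}$, that is, $Exp_h(v)(a,b)=h(a,e^{h^{-1}v}b)$. Moreover $\Gamma(Herm^+(E))$ is open in $\Gamma(Herm(E))$, and $$Exp_h:\Gamma(Herm(E))\to\Gamma(Herm^+(E))$$ is a diffeomorphism: it is bijective, and it and its inverse are smooth in the sense of Bastiani (all iterated directional derivatives exist and are jointly continuous). -/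

import Mathlib

open scoped Manifold ContDiff Topology

noncomputable section

/-! ### Bastiani calculus -/

section Bastiani

variable {X Y : Type*} [AddCommGroup X] [Module ℝ X] [TopologicalSpace X]
  [AddCommGroup Y] [Module ℝ Y] [TopologicalSpace Y]

/-- `d` is the derivative of `f` at `x` in the direction `w`: the limit of the difference quotients
`t⁻¹ (f (x + t w) - f x)` as `t → 0`, `t ≠ 0`. -/
def HasDirDeriv (f : X → Y) (x w : X) (d : Y) : Prop :=
  Filter.Tendsto (fun t : ℝ => t⁻¹ • (f (x + t • w) - f x)) (𝓝[≠] (0 : ℝ)) (𝓝 d)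

/-- `f` is smooth on the (open) set `U` in the sense of Bastiani: all iterated directional
derivatives `d k x (w₁, …, w_k) = D_{w_k} ⋯ D_{w_1} f (x)` exist at the points of `U`, and each of
them is jointly continuous on `U × X ^ k`. -/
def BastianiSmoothOn (f : X → Y) (U : Set X) : Prop :=
  ∃ d : (k : ℕ) → X → (Fin k → X) → Y,
    (∀ x ∈ U, ∀ w, d 0 x w = f x) ∧
    (∀ k, ContinuousOn (fun p : X × (Fin k → X) => d k p.1 p.2) (U ×ˢ Set.univ)) ∧
    ∀ k, ∀ x ∈ U, ∀ (ws : Fin k → X) (w : X),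
      HasDirDeriv (fun y => d k y ws) x w (d (k + 1) x (Fin.snoc ws w))

/-- `f` is a diffeomorphism from the whole space `X` onto the open set `V ⊆ Y`. -/
def IsBastianiDiffeoOnto (f : X → Y) (V : Set Y) : Prop :=
  IsOpen V ∧ (∀ x, f x ∈ V) ∧ BastianiSmoothOn f Set.univ ∧
    ∃ g : Y → X, (∀ x, g (f x) = x) ∧ (∀ y ∈ V, f (g y) = y) ∧ BastianiSmoothOn g V

end Bastiani

/-! ### Sesquilinear forms and endomorphisms of a finite-dimensional complex vector space -/

section Fibre

variable {V : Type*} [AddCommGroup V] [Module ℂ V]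

/-- The endomorphism `h⁻¹ v`: the `A` with `v(a, b) = h(a, A b)` for all `a, b`. It exists and is
unique when `h` is positive definite and `V` is finite-dimensional
(`raise_spec`, `raise_unique`). -/
def raise (h v : V →ₗ[ℂ] V →ₗ⋆[ℂ] ℂ) : Module.End ℂ V :=
  Classical.epsilon fun A => ∀ a b, v a b = h a (A b)

theorem raise_unique {h : V →ₗ[ℂ] V →ₗ⋆[ℂ] ℂ} (hh : ∀ a, a ≠ 0 → 0 < (h a a).re)
    {A B : Module.End ℂ V} (hAB : ∀ a b, h a (A b) = h a (B b)) : A = B := by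
  ext b
  by_contra hne
  have h1 := hh (A b - B b) (sub_ne_zero.mpr hne)
  rw [map_sub (h (A b - B b)), hAB, sub_self] at h1
  simp at h1

theorem raise_spec [FiniteDimensional ℂ V] {h : V →ₗ[ℂ] V →ₗ⋆[ℂ] ℂ}
    (hh : ∀ a, a ≠ 0 → 0 < (h a a).re) (v : V →ₗ[ℂ] V →ₗ⋆[ℂ] ℂ) (a b : V) :
    v a b = h a (raise h v b) := by
  suffices hex : ∃ A : Module.End ℂ V, ∀ a b, v a b = h a (A b) from
    Classical.epsilon_spec hex a b
  let T : V →ₗ[ℝ] (V →ₗ[ℂ] ℂ) :=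
    { toFun := fun β => h.flip β
      map_add' := fun x y => map_add h.flip x y
      map_smul' := fun c x => by
        ext a
        change h a ((c : ℂ) • x) = (c : ℂ) * h a x
        rw [map_smulₛₗ]
        simp }
  have hinj : Function.Injective T := by
    rw [injective_iff_map_eq_zero]
    intro β hβ
    by_contra hne
    have h1 := hh β hne
    have h2 : h β β = 0 := by
      have := congrArg (fun f : V →ₗ[ℂ] ℂ => f β) hβ
      simpa [T] using this
    simp [h2] at h1
  have hfin : FiniteDimensional ℝ V := FiniteDimensional.complexToReal V
  have hfin' : FiniteDimensional ℝ (V →ₗ[ℂ] ℂ) := FiniteDimensional.complexToReal _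
  have hdim : Module.finrank ℝ V = Module.finrank ℝ (V →ₗ[ℂ] ℂ) := by
    rw [finrank_real_of_complex, finrank_real_of_complex, Module.finrank_linearMap]
    simp
  have hsurj : Function.Surjective T :=
    (LinearMap.injective_iff_surjective_of_finrank_eq_finrank hdim).mp hinj
  choose A hA using fun b => hsurj (v.flip b)
  have key : ∀ a b, h a (A b) = v a b := fun a b => by
    have := congrArg (fun f : V →ₗ[ℂ] ℂ => f a) (hA b)
    simpa [T] using this
  refine ⟨{ toFun := A, map_add' := fun x y => ?_, map_smul' := fun c x => ?_ },
    fun a b => (key a b).symm⟩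
  · apply hinj
    ext a
    simp [T, key]
  · apply hinj
    ext a
    simp [T, key]

/-- The exponential `e^A = ∑ A^k / k!` of an endomorphism of a finite-dimensional complex vector
space, computed on matrices (it does not depend on the basis). -/
def endExp [FiniteDimensional ℂ V] (A : Module.End ℂ V) : Module.End ℂ V :=
  Matrix.toLinAlgEquiv (Module.finBasis ℂ V)
    (NormedSpace.exp (LinearMap.toMatrixAlgEquiv (Module.finBasis ℂ V) A))

/-- In any basis, the matrix of `e^A` is the exponential of the matrix of `A`. -/
theorem endExp_basis [FiniteDimensional ℂ V] {ι : Type*} [Fintype ι] [DecidableEq ι]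
    (b : Module.Basis ι ℂ V) (A : Module.End ℂ V) :
    LinearMap.toMatrixAlgEquiv b (endExp A) =
      NormedSpace.exp (LinearMap.toMatrixAlgEquiv b A) := by
  let f : Matrix (Fin (Module.finrank ℂ V)) (Fin (Module.finrank ℂ V)) ℂ ≃ₐ[ℂ] Matrix ι ι ℂ :=
    (Matrix.toLinAlgEquiv (Module.finBasis ℂ V)).trans (LinearMap.toMatrixAlgEquiv b)
  have hf : Continuous f := LinearMap.continuous_of_finiteDimensional f.toLinearMap
  let _ : NormedRing (Matrix (Fin (Module.finrank ℂ V)) (Fin (Module.finrank ℂ V)) ℂ) :=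
    Matrix.linftyOpNormedRing
  let _ : NormedAlgebra ℂ (Matrix (Fin (Module.finrank ℂ V)) (Fin (Module.finrank ℂ V)) ℂ) :=
    Matrix.linftyOpNormedAlgebra
  let _ : NormedAlgebra ℚ (Matrix (Fin (Module.finrank ℂ V)) (Fin (Module.finrank ℂ V)) ℂ) :=
    NormedAlgebra.restrictScalars ℚ ℂ _
  let _ : NormedRing (Matrix ι ι ℂ) := Matrix.linftyOpNormedRing
  have h := NormedSpace.map_exp f hf (LinearMap.toMatrixAlgEquiv (Module.finBasis ℂ V) A)
  have h2 : f (LinearMap.toMatrixAlgEquiv (Module.finBasis ℂ V) A) =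
      LinearMap.toMatrixAlgEquiv b A := by
    simp [f]
  rw [h2] at h
  exact h

end Fibre

/-! ### Complex vector bundles over a manifold, and the space of smooth Hermitian forms -/

section Bundle

variable {n : ℕ} {M : Type*} [TopologicalSpace M] [ChartedSpace (EuclideanSpace ℝ (Fin n)) M]
  {F : Type*} [NormedAddCommGroup F] [NormedSpace ℂ F]
  {E : M → Type*} [TopologicalSpace (Bundle.TotalSpace F E)] [∀ x, TopologicalSpace (E x)]
  [∀ x, AddCommGroup (E x)] [∀ x, Module ℂ (E x)] [FiberBundle F E] [VectorBundle ℂ F E]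

/-- The real vector bundle underlying a complex vector bundle. -/
instance realVectorBundle {M : Type*} [TopologicalSpace M]
    {F : Type*} [NormedAddCommGroup F] [NormedSpace ℂ F]
    {E : M → Type*} [TopologicalSpace (Bundle.TotalSpace F E)] [∀ x, TopologicalSpace (E x)]
    [∀ x, AddCommGroup (E x)] [∀ x, Module ℂ (E x)] [FiberBundle F E] [VectorBundle ℂ F E] :
    VectorBundle ℝ F E := by
  have lin : ∀ (e : Bundle.Trivialization F (Bundle.TotalSpace.proj : Bundle.TotalSpace F E → M))
      [MemTrivializationAtlas e], e.IsLinear ℝ := fun e _ =>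
    ⟨fun b hb =>
      ⟨(e.linear ℂ hb).map_add, fun c x => (e.linear ℂ hb).map_smul (c : ℂ) x⟩⟩
  refine ⟨fun e _ => lin e, fun e e' _ _ => ?_⟩
  have := lin e
  have := lin e'
  have h1 := continuousOn_coordChange (R := ℂ) (F := F) (E := E) e e'
  have h2 := (ContinuousLinearMap.restrictScalarsL ℂ F F ℝ ℝ).continuous.comp_continuousOn h1
  refine h2.congr fun b hb => ?_
  ext y
  change e.coordChangeL ℝ e' b y = e.coordChangeL ℂ e' b y
  rw [Bundle.Trivialization.coordChangeL_apply e e' hb,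
    Bundle.Trivialization.coordChangeL_apply e e' hb]

variable (n F E)

/-- The coefficient `x ↦ s(x)(aˣ, bˣ)` of a family `s` of sesquilinear forms, where `aˣ` and `bˣ`
are the vectors of `E x` that correspond to the constants `a` and `b` of the model fibre `F` in the
trivialization of `E` at `x₀`. For `a, b` in a basis of `F` these are the entries of the matrix of
`s` in the corresponding local frame. -/
def coeffAt (s : ∀ x, E x →ₗ[ℂ] E x →ₗ⋆[ℂ] ℂ) (x₀ : M) (a b : F) (x : M) : ℂ :=
  s x ((trivializationAt F E x₀).symm x a) ((trivializationAt F E x₀).symm x b)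

/-- The real vector space `Γ(Herm(E))` of smooth sections of `Herm(E)`: families of Hermitian
sesquilinear forms (linear in the first, conjugate linear in the second variable) on the fibres,
whose matrices in the local frames are smooth. -/
def hermSections : Submodule ℝ (∀ x, E x →ₗ[ℂ] E x →ₗ⋆[ℂ] ℂ) where
  carrier := {s | (∀ x a b, s x b a = star (s x a b)) ∧
    ∀ (x₀ : M) (a b : F), ContMDiffOn (𝓡 n) 𝓘(ℝ, ℂ) ∞ (coeffAt F E s x₀ a b)
      (trivializationAt F E x₀).baseSet}
  add_mem' := by
    rintro s t ⟨hs, hs'⟩ ⟨ht, ht'⟩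
    refine ⟨fun x a b => ?_, fun x₀ a b => (hs' x₀ a b).add (ht' x₀ a b)⟩
    simp only [Pi.add_apply, LinearMap.add_apply, star_add]
    rw [hs, ht]
  zero_mem' := by
    refine ⟨fun x a b => by simp, fun x₀ a b => ?_⟩
    exact (contMDiffOn_const (c := (0 : ℂ)))
  smul_mem' := by
    rintro c s ⟨hs, hs'⟩
    refine ⟨fun x a b => ?_, fun x₀ a b => ?_⟩
    · have : ∀ a b, (c • s) x a b = (c : ℂ) * s x a b := fun a b => rfl
      rw [this, this, hs x a b]
      simp
    · exact ((c • ContinuousLinearMap.id ℝ ℂ).contMDiff (n := ∞)).comp_contMDiffOn (hs' x₀ a b)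

/-- `Γ(Herm(E))` as a type; it carries the smooth compact-open topology defined below. -/
def HermSection : Type _ := ↥(hermSections n F E)

instance : AddCommGroup (HermSection n F E) := inferInstanceAs (AddCommGroup ↥(hermSections n F E))

instance : Module ℝ (HermSection n F E) := inferInstanceAs (Module ℝ ↥(hermSections n F E))

variable {n F E}

/-- The value of a section at a point. -/
def HermSection.form (s : HermSection n F E) (x : M) : E x →ₗ[ℂ] E x →ₗ⋆[ℂ] ℂ := s.1 x

variable (n F E)

/-- The open set of `ℝⁿ` on which both the chart of `M` and the trivialization of `E` at `x₀` are
defined. -/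
def localDomain (x₀ : M) : Set (EuclideanSpace ℝ (Fin n)) :=
  (chartAt (EuclideanSpace ℝ (Fin n)) x₀).target ∩
    (chartAt (EuclideanSpace ℝ (Fin n)) x₀).symm ⁻¹' (trivializationAt F E x₀).baseSet

/-- The coefficients of `s` in the chart and the trivialization at `x₀`. -/
def localCoeff (x₀ : M) (a b : F) (s : HermSection n F E) : EuclideanSpace ℝ (Fin n) → ℂ :=
  fun y => coeffAt F E s.form x₀ a b ((chartAt (EuclideanSpace ℝ (Fin n)) x₀).symm y)

/-- The smooth compact-open topology: uniform convergence, on compact subsets of the local domains,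
of all the partial derivatives of the coefficients. -/
instance : TopologicalSpace (HermSection n F E) :=
  ⨅ (x₀ : M) (a : F) (b : F) (k : ℕ),
    TopologicalSpace.induced
      (fun s => UniformOnFun.ofFun {K | IsCompact K ∧ K ⊆ localDomain n F E x₀}
        (iteratedFDeriv ℝ k (localCoeff n F E x₀ a b s)))
      inferInstance

/-- `Γ(Herm⁺(E))`, the set of smooth Hermitian metrics on `E`. -/
def hermMetrics : Set (HermSection n F E) :=
  {h | ∀ x (a : E x), a ≠ 0 → 0 < (h.form x a a).re}

/-- The fibres of a complex vector bundle of finite rank are finite-dimensional. -/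
theorem finiteDimensional_fibre {M : Type*} [TopologicalSpace M]
    (F : Type*) [NormedAddCommGroup F] [NormedSpace ℂ F] [FiniteDimensional ℂ F]
    (E : M → Type*) [TopologicalSpace (Bundle.TotalSpace F E)] [∀ x, TopologicalSpace (E x)]
    [∀ x, AddCommGroup (E x)] [∀ x, Module ℂ (E x)] [FiberBundle F E] [VectorBundle ℂ F E]
    (x : M) : FiniteDimensional ℂ (E x) :=
  ((trivializationAt F E x).linearEquivAt ℂ x
    (FiberBundle.mem_baseSet_trivializationAt F E x)).symm.finiteDimensional

/-- The exponential `e^A` of an endomorphism `A` of the fibre `E x`. -/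
def fibreExp {M : Type*} [TopologicalSpace M]
    (F : Type*) [NormedAddCommGroup F] [NormedSpace ℂ F] [FiniteDimensional ℂ F]
    {E : M → Type*} [TopologicalSpace (Bundle.TotalSpace F E)] [∀ x, TopologicalSpace (E x)]
    [∀ x, AddCommGroup (E x)] [∀ x, Module ℂ (E x)] [FiberBundle F E] [VectorBundle ℂ F E]
    {x : M} (A : Module.End ℂ (E x)) : Module.End ℂ (E x) :=
  haveI := finiteDimensional_fibre F E x
  endExp A

variable {n F E}

/-! ### The `L²` metric, its geodesics and its exponential map -/

section Geodesics

variable [MeasurableSpace M] (μ : MeasureTheory.Measure M) (α : M → ℝ)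

/-- The (weak) Riemannian metric
`(v, w)_h = ∫ tr(h⁻¹ v h⁻¹ w) + α tr(h⁻¹ v) tr(h⁻¹ w) dμ` on `Γ(Herm⁺(E))`, whose tangent space at
each `h` is `Γ(Herm(E))`. The integrand takes real values, so that taking its real part only
changes its type. -/
def l2Metric (h v w : HermSection n F E) : ℝ :=
  ∫ x, (LinearMap.trace ℂ (E x) (raise (h.form x) (v.form x) * raise (h.form x) (w.form x)) +
    (α x : ℂ) * LinearMap.trace ℂ (E x) (raise (h.form x) (v.form x)) *
      LinearMap.trace ℂ (E x) (raise (h.form x) (w.form x))).re ∂μ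

/-- `b` is the value `B_h(v, v)` of the metric spray of the `L²` metric: for all `l`,
`(b, l)_h = 1/2 D(v, v)_h(l) - D(v, l)_h(v)`, where `D` is the derivative with respect to the base
point `h`. -/
def IsSprayValue (h v b : HermSection n F E) : Prop :=
  ∀ l : HermSection n F E, ∃ p q : ℝ,
    HasDirDeriv (fun k => l2Metric μ α k v v) h l p ∧
    HasDirDeriv (fun k => l2Metric μ α k v l) h v q ∧
    l2Metric μ α h b l = p / 2 - q

/-- `γ` is a geodesic of the `L²` metric, defined for all times: a smooth curve of Hermitian
metrics with `γ'' = B_γ(γ', γ')`. -/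
def IsL2Geodesic (γ : ℝ → HermSection n F E) : Prop :=
  (∀ t, γ t ∈ hermMetrics n F E) ∧ BastianiSmoothOn γ Set.univ ∧
    ∃ γ₁ γ₂ : ℝ → HermSection n F E,
      (∀ t, HasDirDeriv γ t 1 (γ₁ t)) ∧ (∀ t, HasDirDeriv γ₁ t 1 (γ₂ t)) ∧
      ∀ t, IsSprayValue μ α (γ t) (γ₁ t) (γ₂ t)

/-- `γ` is a geodesic with `γ(0) = h` and `γ'(0) = v`. -/
def IsL2GeodesicFrom (h v : HermSection n F E) (γ : ℝ → HermSection n F E) : Prop :=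
  IsL2Geodesic μ α γ ∧ γ 0 = h ∧ HasDirDeriv γ 0 1 v

/-- The exponential map at `h` of the `L²` metric: `Exp_h(v) = γ(1)` for the geodesic `γ` with
`γ(0) = h` and `γ'(0) = v`. -/
def Exp (h v : HermSection n F E) : HermSection n F E :=
  Classical.epsilon (IsL2GeodesicFrom μ α h v) 1

end Geodesics

end Bundle

end

/-!
The exponential map of the `L²` metric on the space of Hermitian metrics of a vector bundle.

Two facts make everything explicit. First, the metric spray can be solved for pointwise: by the
cyclicity of the trace, the section `b = v h⁻¹ v` satisfies
`(b, l)_h = 1/2 D(v, v)_h(l) - D(v, l)_h(v)` for all `l`, whatever `α` is (`traceDensity_spray`,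
`isSprayValue_of_gram`), and it is the only such section because the metric is nondegenerate
(`IsSprayValue.unique`). Nondegeneracy is where `r α > -1` enters: after a simultaneous
diagonalization of `h` and `v` the integrand of `(v, v)_h` is `∑ dᵢ² + α (∑ dᵢ)²`, and
`(∑ dᵢ)² ≤ r ∑ dᵢ²` (`trace_form_pos`); that `μ` is positive on open sets then gives `v = 0`.
So `γ` is a geodesic exactly if it solves `γ'' = γ' γ⁻¹ γ'` in every fibre. This equation says that
`γ⁻¹ γ'` is constant, and its solution is `γ(t) = h e^{t h⁻¹ v}` (`eq_formExp_of_hasDerivAt`).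

Second, the pointwise formulas `H e^{H⁻¹ V}` and `H log(H⁻¹ K)` are given by smooth maps, on open
sets of pairs of matrices, that commute with the congruences `X ↦ P X Pᴴ` and with `X ↦ Xᴴ`
(`IsNaturalOp`). Such a map acts on sections, and so do its iterated derivatives `iterOp`, since they inherit the
symmetries (`IsNaturalOp.exists_section`). These actions are the iterated directional derivatives of
the induced map on sections, which is therefore smooth in the sense of Bastiani
(`IsNaturalOp.bastianiSmoothOn`). The logarithm is defined by the integral
`∫₀¹ D - s D (H + s D)⁻¹ D ds` with `D = K - H`, which needs no spectral theory to be smooth and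
natural; that it inverts the exponential is checked on diagonal matrices (`formLog_diagonal`).

The analysis takes place in the smooth compact-open topology through the notion `CkTendsto` of `C^k`
convergence of Gram matrices in charts (`HermSection.tendsto_iff`), which is stable under
composition with smooth maps (`CkTendsto.comp_left`) and holds for difference quotients of smooth
maps (`CkTendsto.quotient`). The integrand of the metric is differentiated under the integral by
means of locally uniform convergence on the compact manifold.
-/

noncomputable section

/-! ### Convergence of all derivatives, locally uniformly on an open set -/

section CkConvergence

universe u

variable {ι : Type*} {E : Type u} [NormedAddCommGroup E] [NormedSpace ℝ E]

/-- The functions `g p` converge to `g₀` in `C^k` on `Ω` along the filter `l`. Locally uniform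
convergence is encoded as continuous convergence: `g p y → g₀ y₀` as `p → l` and `y → y₀`, for each
`y₀ ∈ Ω`; the derivatives are treated by recursion. -/
def CkTendsto (l : Filter ι) (Ω : Set E) : (k : ℕ) → {Z : Type u} → [NormedAddCommGroup Z] →
    [NormedSpace ℝ Z] → (ι → E → Z) → (E → Z) → Prop
  | 0, _, _, _, g, g₀ =>
    ∀ y ∈ Ω, Filter.Tendsto (fun q : ι × E => g q.1 q.2) (l ×ˢ 𝓝 y) (𝓝 (g₀ y))
  | k + 1, _, _, _, g, g₀ =>
    (∀ y ∈ Ω, Filter.Tendsto (fun q : ι × E => g q.1 q.2) (l ×ˢ 𝓝 y) (𝓝 (g₀ y))) ∧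
    (∀ᶠ p in l, DifferentiableOn ℝ (g p) Ω) ∧ DifferentiableOn ℝ g₀ Ω ∧
    CkTendsto l Ω k (fun p => fderiv ℝ (g p)) (fderiv ℝ g₀)

namespace CkTendsto

variable {l : Filter ι} {Ω : Set E}
  {Z : Type u} [NormedAddCommGroup Z] [NormedSpace ℝ Z]
  {Y : Type u} [NormedAddCommGroup Y] [NormedSpace ℝ Y]
  {G : Type u} [NormedAddCommGroup G] [NormedSpace ℝ G]

theorem tendsto {k : ℕ} {g : ι → E → Z} {g₀ : E → Z} (h : CkTendsto l Ω k g g₀) {y : E}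
    (hy : y ∈ Ω) : Filter.Tendsto (fun q : ι × E => g q.1 q.2) (l ×ˢ 𝓝 y) (𝓝 (g₀ y)) := by
  cases k with
  | zero => exact h y hy
  | succ k => exact h.1 y hy

theorem of_succ {k : ℕ} {g : ι → E → Z} {g₀ : E → Z} (h : CkTendsto l Ω (k + 1) g g₀) :
    CkTendsto l Ω k g g₀ := by
  induction k generalizing Z with
  | zero => exact h.1
  | succ k ih => exact ⟨h.1, h.2.1, h.2.2.1, ih h.2.2.2⟩

theorem congr (hΩ : IsOpen Ω) {k : ℕ} {g g' : ι → E → Z} {g₀ g₀' : E → Z}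
    (h : CkTendsto l Ω k g g₀) (hg : ∀ᶠ p in l, Set.EqOn (g p) (g' p) Ω)
    (hg₀ : Set.EqOn g₀ g₀' Ω) : CkTendsto l Ω k g' g₀' := by
  induction k generalizing Z with
  | zero =>
    intro y hy
    rw [← hg₀ hy]
    refine (h y hy).congr' ?_
    filter_upwards [hg.prod_mk (hΩ.mem_nhds hy)] with q hq using hq.1 hq.2
  | succ k ih =>
    refine ⟨?_, ?_, ?_, ?_⟩
    · intro y hy
      rw [← hg₀ hy]
      refine (h.1 y hy).congr' ?_
      filter_upwards [hg.prod_mk (hΩ.mem_nhds hy)] with q hq using hq.1 hq.2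
    · filter_upwards [hg, h.2.1] with p hp hp' using hp'.congr hp.symm
    · exact h.2.2.1.congr hg₀.symm
    · have key : ∀ {f f' : E → Z}, Set.EqOn f f' Ω → Set.EqOn (fderiv ℝ f) (fderiv ℝ f') Ω :=
        fun hf y hy => (hf.eventuallyEq_of_mem (hΩ.mem_nhds hy)).fderiv_eq
      exact ih h.2.2.2 (hg.mono fun p hp => key hp) (key hg₀)

theorem clm_comp (hΩ : IsOpen Ω) {k : ℕ} {g : ι → E → Z} {g₀ : E → Z}
    (h : CkTendsto l Ω k g g₀) (L : Z →L[ℝ] Y) :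
    CkTendsto l Ω k (fun p y => L (g p y)) (fun y => L (g₀ y)) := by
  induction k generalizing Z Y with
  | zero => exact fun y hy => (L.continuous.tendsto _).comp (h y hy)
  | succ k ih =>
    refine ⟨fun y hy => (L.continuous.tendsto _).comp (h.1 y hy),
      h.2.1.mono fun p hp => L.differentiable.comp_differentiableOn hp,
      L.differentiable.comp_differentiableOn h.2.2.1, ?_⟩
    refine (ih h.2.2.2 (ContinuousLinearMap.compL ℝ E Z Y L)).congr hΩ ?_ ?_
    · filter_upwards [h.2.1] with p hp y hy
      exact (L.hasFDerivAt.comp y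
        ((hp y hy).differentiableAt (hΩ.mem_nhds hy)).hasFDerivAt).fderiv.symm
    · intro y hy
      exact (L.hasFDerivAt.comp y
        ((h.2.2.1 y hy).differentiableAt (hΩ.mem_nhds hy)).hasFDerivAt).fderiv.symm

theorem prodMk (hΩ : IsOpen Ω) {k : ℕ} {g : ι → E → Z} {g₀ : E → Z} {f : ι → E → Y} {f₀ : E → Y}
    (h : CkTendsto l Ω k g g₀) (h' : CkTendsto l Ω k f f₀) :
    CkTendsto l Ω k (fun p y => (g p y, f p y)) (fun y => (g₀ y, f₀ y)) := by
  induction k generalizing Z Y with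
  | zero => exact fun y hy => (h y hy).prodMk_nhds (h' y hy)
  | succ k ih =>
    refine ⟨fun y hy => (h.1 y hy).prodMk_nhds (h'.1 y hy), ?_, h.2.2.1.prodMk h'.2.2.1, ?_⟩
    · filter_upwards [h.2.1, h'.2.1] with p hp hp' using hp.prodMk hp'
    · refine ((ih h.2.2.2 h'.2.2.2).clm_comp hΩ
        (ContinuousLinearMap.prodL ℝ (E := E) (F := Z) (G := Y)).toContinuousLinearMap).congr hΩ ?_ ?_
      · filter_upwards [h.2.1, h'.2.1] with p hp hp' y hy
        exact (((hp y hy).differentiableAt (hΩ.mem_nhds hy)).hasFDerivAt.prodMk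
          ((hp' y hy).differentiableAt (hΩ.mem_nhds hy)).hasFDerivAt).fderiv.symm
      · intro y hy
        exact (((h.2.2.1 y hy).differentiableAt (hΩ.mem_nhds hy)).hasFDerivAt.prodMk
          ((h'.2.2.1 y hy).differentiableAt (hΩ.mem_nhds hy)).hasFDerivAt).fderiv.symm

theorem const (k : ℕ) {c : ι → Z} {c₀ : Z} (h : Filter.Tendsto c l (𝓝 c₀)) :
    CkTendsto l Ω k (fun p _ => c p) (fun _ => c₀) := by
  induction k generalizing Z with
  | zero => exact fun y _ => h.comp Filter.tendsto_fst
  | succ k ih =>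
    refine ⟨fun y _ => h.comp Filter.tendsto_fst, .of_forall fun p => differentiableOn_const _,
      differentiableOn_const _, ?_⟩
    have : ∀ c : Z, fderiv ℝ (fun _ : E => c) = fun _ => 0 := fun c => by
      ext1 y; exact fderiv_const_apply c
    simp only [this]
    exact ih tendsto_const_nhds

theorem sum (hΩ : IsOpen Ω) {k : ℕ} {σ : Type*} (S : Finset σ) {g : σ → ι → E → Z}
    {g₀ : σ → E → Z} (h : ∀ i ∈ S, CkTendsto l Ω k (g i) (g₀ i)) :
    CkTendsto l Ω k (fun p y => ∑ i ∈ S, g i p y) (fun y => ∑ i ∈ S, g₀ i y) := by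
  classical
  induction S using Finset.induction_on with
  | empty => simpa using CkTendsto.const k tendsto_const_nhds
  | insert a S ha ih =>
    simp only [Finset.sum_insert ha]
    exact ((h a (by simp)).prodMk hΩ (ih fun i hi => h i (by simp [hi]))).clm_comp hΩ
      (ContinuousLinearMap.fst ℝ Z Z + ContinuousLinearMap.snd ℝ Z Z)

theorem pi (hΩ : IsOpen Ω) {k : ℕ} {σ : Type} [Fintype σ] {Z : Type u}
    [NormedAddCommGroup Z] [NormedSpace ℝ Z] {g : σ → ι → E → Z}
    {g₀ : σ → E → Z} (h : ∀ i, CkTendsto l Ω k (g i) (g₀ i)) :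
    CkTendsto l Ω k (fun p y i => g i p y) (fun y i => g₀ i y) := by
  classical
  have := CkTendsto.sum hΩ Finset.univ fun i _ =>
    (h i).clm_comp hΩ (ContinuousLinearMap.single ℝ (fun _ : σ => Z) i)
  simpa [Finset.univ_sum_single] using this

/-- Composition from the left with a smooth function preserves `C^k` convergence: by the chain
rule, the derivative of `f ∘ g` is a smooth function `(z, A) ↦ f'(z) ∘ A` of the pair `(g, g')`, so
that induction on `k` applies. -/
theorem comp_left (hΩ : IsOpen Ω) {k : ℕ} {O : Set Z} (hO : IsOpen O) {f : Z → G}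
    (hf : ContDiffOn ℝ ∞ f O) {g : ι → E → Z} {g₀ : E → Z} (h : CkTendsto l Ω k g g₀)
    (hg : ∀ᶠ p in l, Set.MapsTo (g p) Ω O) (hg₀ : Set.MapsTo g₀ Ω O) :
    CkTendsto l Ω k (fun p y => f (g p y)) (fun y => f (g₀ y)) := by
  have h0 : ∀ y ∈ Ω, Filter.Tendsto (fun q : ι × E => f (g q.1 q.2)) (l ×ˢ 𝓝 y) (𝓝 (f (g₀ y))) :=
    fun y hy => ((hf.continuousOn.continuousAt (hO.mem_nhds (hg₀ hy))).tendsto).comp (h.tendsto hy)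
  induction k generalizing Z G with
  | zero => exact h0
  | succ k ih =>
    have hdf : ∀ {z}, z ∈ O → HasFDerivAt f (fderiv ℝ f z) z := fun hz =>
      ((hf.differentiableOn (by simp)).differentiableAt (hO.mem_nhds hz)).hasFDerivAt
    have hc : ∀ {g : E → Z}, DifferentiableOn ℝ g Ω → Set.MapsTo g Ω O → ∀ y ∈ Ω,
        HasFDerivAt (fun y => f (g y)) (fderiv ℝ f (g y) ∘L fderiv ℝ g y) y := fun hd hm y hy =>
      (hdf (hm hy)).comp y ((hd y hy).differentiableAt (hΩ.mem_nhds hy)).hasFDerivAt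
    have hf' : ContDiffOn ℝ ∞ (fun z : Z × (E →L[ℝ] Z) => fderiv ℝ f z.1 ∘L z.2)
        (O ×ˢ Set.univ) := by
      have := (hf.fderiv_of_isOpen hO (m := ∞) (by simp)).comp
        (contDiff_fst (E := Z) (F := E →L[ℝ] Z)).contDiffOn
        (fun z (hz : z ∈ O ×ˢ Set.univ) => hz.1)
      exact this.clm_comp contDiff_snd.contDiffOn
    refine ⟨h0, ?_, fun y hy => (hc h.2.2.1 hg₀ y hy).differentiableAt.differentiableWithinAt, ?_⟩
    · filter_upwards [h.2.1, hg] with p hp hp' y hy using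
        (hc hp hp' y hy).differentiableAt.differentiableWithinAt
    · have hpair := h.of_succ.prodMk hΩ h.2.2.2
      refine (ih (hO.prod isOpen_univ) hf' hpair (hg.mono fun p hp y hy => ⟨hp hy, trivial⟩)
        (fun y hy => ⟨hg₀ hy, trivial⟩) ?_).congr hΩ ?_ fun y hy => (hc h.2.2.1 hg₀ y hy).fderiv.symm
      · exact fun y hy => ((hf'.continuousOn.continuousAt ((hO.prod isOpen_univ).mem_nhds
          ⟨hg₀ hy, trivial⟩)).tendsto).comp (hpair.tendsto hy)
      · filter_upwards [h.2.1, hg] with p hp hp' y hy using (hc hp hp' y hy).fderiv.symm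

end CkTendsto

/-- Difference quotients of a strictly differentiable function, with moving base point and moving
direction. -/
theorem HasStrictFDerivAt.tendsto_quotient {ι Z G : Type*} [NormedAddCommGroup Z] [NormedSpace ℝ Z]
    [NormedAddCommGroup G] [NormedSpace ℝ G] {l : Filter ι} {f : Z → G} {f' : Z →L[ℝ] G} {z₀ : Z}
    (hf : HasStrictFDerivAt f f' z₀) {t : ι → ℝ} (ht : Filter.Tendsto t l (𝓝[≠] 0)) {z w : ι → Z}
    {w₀ : Z} (hz : Filter.Tendsto z l (𝓝 z₀)) (hw : Filter.Tendsto w l (𝓝 w₀)) :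
    Filter.Tendsto (fun i => (t i)⁻¹ • (f (z i + t i • w i) - f (z i))) l (𝓝 (f' w₀)) := by
  have ht0 : Filter.Tendsto t l (𝓝 0) := ht.mono_right nhdsWithin_le_nhds
  have hpair : Filter.Tendsto (fun i => (z i + t i • w i, z i)) l (𝓝 (z₀, z₀)) := by
    refine Filter.Tendsto.prodMk_nhds ?_ hz
    simpa using hz.add (ht0.smul hw)
  have h1 := hf.isLittleO.comp_tendsto hpair
  have h2 : (fun i => (t i)⁻¹ • (f (z i + t i • w i) - f (z i)) - f' (w i)) =o[l]
      (fun i => w i) := by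
    have h3 := (Asymptotics.isBigO_refl (fun i => (t i)⁻¹) l).smul_isLittleO h1
    refine h3.congr' ?_ ?_
    · filter_upwards [ht.eventually self_mem_nhdsWithin] with i hi
      have hi : t i ≠ 0 := hi
      simp [smul_sub, smul_smul, hi]
    · filter_upwards [ht.eventually self_mem_nhdsWithin] with i hi
      have hi : t i ≠ 0 := hi
      simp [smul_smul, hi]
  have h4 := (h2.trans_isBigO (hw.isBigO_one ℝ)).tendsto_zero_of_tendsto tendsto_const_nhds
    |>.add ((f'.continuous.tendsto _).comp hw)
  simpa using h4

/-- Difference quotients of `s ↦ f ∘ s` in the direction `w` converge in `C^k` to the derivative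
`y ↦ f'(s y) (w y)`. The `y`-derivative of the quotient of `f` is the quotient of
`(z, A) ↦ f'(z) ∘ A` at `(s, s')` in the direction `(w, w')`. -/
theorem CkTendsto.quotient {Ω : Set E} (hΩ : IsOpen Ω)
    {Z G : Type u} [NormedAddCommGroup Z] [NormedSpace ℝ Z]
    [NormedAddCommGroup G] [NormedSpace ℝ G] {O : Set Z} (hO : IsOpen O)
    {f : Z → G} (hf : ContDiffOn ℝ ∞ f O) {s w : E → Z} (hs : ContDiffOn ℝ ∞ s Ω)
    (hw : ContDiffOn ℝ ∞ w Ω) (hsO : Set.MapsTo s Ω O)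
    (hswO : ∀ᶠ t in 𝓝[≠] (0 : ℝ), ∀ y ∈ Ω, s y + t • w y ∈ O) (k : ℕ) :
    CkTendsto (𝓝[≠] (0 : ℝ)) Ω k (fun t y => t⁻¹ • (f (s y + t • w y) - f (s y)))
      (fun y => fderiv ℝ f (s y) (w y)) := by
  induction k generalizing Z G with
  | zero =>
    intro y hy
    have hst : HasStrictFDerivAt f (fderiv ℝ f (s y)) (s y) :=
      (hf.contDiffAt (hO.mem_nhds (hsO hy))).hasStrictFDerivAt (by simp)
    exact hst.tendsto_quotient Filter.tendsto_fst
      (((hs.continuousOn.continuousAt (hΩ.mem_nhds hy)).tendsto).comp Filter.tendsto_snd)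
      (((hw.continuousOn.continuousAt (hΩ.mem_nhds hy)).tendsto).comp Filter.tendsto_snd)
  | succ k ih =>
    have hdf : ∀ {z}, z ∈ O → HasFDerivAt f (fderiv ℝ f z) z := fun hz =>
      ((hf.differentiableOn (by simp)).differentiableAt (hO.mem_nhds hz)).hasFDerivAt
    have hf1 : ContDiffOn ℝ ∞ (fderiv ℝ f) O := hf.fderiv_of_isOpen hO (by simp)
    have hdf1 : ∀ {z}, z ∈ O → HasFDerivAt (fderiv ℝ f) (fderiv ℝ (fderiv ℝ f) z) z := fun hz =>
      ((hf1.differentiableOn (by simp)).differentiableAt (hO.mem_nhds hz)).hasFDerivAt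
    have hds : ∀ y ∈ Ω, HasFDerivAt s (fderiv ℝ s y) y := fun y hy =>
      ((hs.differentiableOn (by simp)).differentiableAt (hΩ.mem_nhds hy)).hasFDerivAt
    have hdw : ∀ y ∈ Ω, HasFDerivAt w (fderiv ℝ w y) y := fun y hy =>
      ((hw.differentiableOn (by simp)).differentiableAt (hΩ.mem_nhds hy)).hasFDerivAt
    have hf' : ContDiffOn ℝ ∞ (fun z : Z × (E →L[ℝ] Z) => fderiv ℝ f z.1 ∘L z.2)
        (O ×ˢ Set.univ) := by
      have := hf1.comp (contDiff_fst (E := Z) (F := E →L[ℝ] Z)).contDiffOn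
        (fun z (hz : z ∈ O ×ˢ Set.univ) => hz.1)
      exact this.clm_comp contDiff_snd.contDiffOn
    have hq : ∀ t : ℝ, (∀ y ∈ Ω, s y + t • w y ∈ O) → ∀ y ∈ Ω,
        HasFDerivAt (fun y => t⁻¹ • (f (s y + t • w y) - f (s y)))
          (t⁻¹ • (fderiv ℝ f (s y + t • w y) ∘L (fderiv ℝ s y + t • fderiv ℝ w y) -
            fderiv ℝ f (s y) ∘L fderiv ℝ s y)) y := fun t ht y hy =>
      (((hdf (ht y hy)).comp y ((hds y hy).add ((hdw y hy).const_smul t))).sub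
        ((hdf (hsO hy)).comp y (hds y hy))).const_smul t⁻¹
    have hlim : ∀ y ∈ Ω, HasFDerivAt (fun y => fderiv ℝ f (s y) (w y))
        (fderiv ℝ f (s y) ∘L fderiv ℝ w y +
          (fderiv ℝ (fderiv ℝ f) (s y) ∘L fderiv ℝ s y).flip (w y)) y := fun y hy =>
      ((hdf1 (hsO hy)).comp y (hds y hy)).clm_apply (hdw y hy)
    refine ⟨?_, ?_, fun y hy => (hlim y hy).differentiableAt.differentiableWithinAt, ?_⟩
    · intro y hy
      have hst : HasStrictFDerivAt f (fderiv ℝ f (s y)) (s y) :=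
        (hf.contDiffAt (hO.mem_nhds (hsO hy))).hasStrictFDerivAt (by simp)
      exact hst.tendsto_quotient Filter.tendsto_fst
        (((hs.continuousOn.continuousAt (hΩ.mem_nhds hy)).tendsto).comp Filter.tendsto_snd)
        (((hw.continuousOn.continuousAt (hΩ.mem_nhds hy)).tendsto).comp Filter.tendsto_snd)
    · filter_upwards [hswO] with t ht y hy using
        (hq t ht y hy).differentiableAt.differentiableWithinAt
    · refine (ih (hO.prod isOpen_univ) hf'
        (hs.prodMk (hs.fderiv_of_isOpen hΩ (m := ∞) (by simp)))
        (hw.prodMk (hw.fderiv_of_isOpen hΩ (m := ∞) (by simp)))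
        (fun y hy => ⟨hsO hy, trivial⟩) ?_).congr hΩ ?_ ?_
      · filter_upwards [hswO] with t ht y hy using ⟨ht y hy, trivial⟩
      · filter_upwards [hswO] with t ht y hy using (hq t ht y hy).fderiv.symm
      · intro y hy
        -- `D²f` applied to `(w, s' ξ)` occurs on one side, and to `(s' ξ, w)` on the other
        have hsymm : IsSymmSndFDerivAt ℝ f (s y) :=
          (hf.contDiffAt (hO.mem_nhds (hsO hy))).isSymmSndFDerivAt
            (by
              rw [minSmoothness_of_isRCLikeNormedField]
              exact WithTop.coe_le_coe.2 (le_top : (2 : ℕ∞) ≤ ⊤))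
        have h1 : HasFDerivAt (fun z : Z × (E →L[ℝ] Z) => fderiv ℝ f z.1 ∘L z.2) _
            (s y, fderiv ℝ s y) :=
          HasFDerivAt.clm_comp ((hdf1 (hsO hy)).comp (s y, fderiv ℝ s y) hasFDerivAt_fst)
            hasFDerivAt_snd
        change fderiv ℝ _ (s y, fderiv ℝ s y) (w y, fderiv ℝ w y) = _
        rw [(hlim y hy).fderiv, h1.fderiv]
        ext ξ
        simp [hsymm.eq (w y)]

/-- The recursive definition of `C^k` convergence agrees with the one by iterated derivatives, which
is used by the smooth compact-open topology. -/
theorem ckTendsto_iff_iteratedFDeriv {l : Filter ι} {Ω : Set E} (hΩ : IsOpen Ω) {Z : Type u}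
    [NormedAddCommGroup Z] [NormedSpace ℝ Z] {g : ι → E → Z} {g₀ : E → Z}
    (hg : ∀ p, ContDiffOn ℝ ∞ (g p) Ω) (hg₀ : ContDiffOn ℝ ∞ g₀ Ω) (k : ℕ) :
    CkTendsto l Ω k g g₀ ↔ ∀ j ≤ k, ∀ y ∈ Ω, Filter.Tendsto
      (fun q : ι × E => iteratedFDeriv ℝ j (g q.1) q.2) (l ×ˢ 𝓝 y)
      (𝓝 (iteratedFDeriv ℝ j g₀ y)) := by
  have h0 : ∀ {Z : Type u} [NormedAddCommGroup Z] [NormedSpace ℝ Z] (g : ι → E → Z) (g₀ : E → Z)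
      (y : E), Filter.Tendsto (fun q : ι × E => iteratedFDeriv ℝ 0 (g q.1) q.2) (l ×ˢ 𝓝 y)
      (𝓝 (iteratedFDeriv ℝ 0 g₀ y)) ↔
      Filter.Tendsto (fun q : ι × E => g q.1 q.2) (l ×ˢ 𝓝 y) (𝓝 (g₀ y)) := by
    intro Z _ _ g g₀ y
    simp only [iteratedFDeriv_zero_eq_comp, Function.comp_apply]
    exact (((continuousMultilinearCurryFin0 ℝ E Z).symm.toHomeomorph.isEmbedding).tendsto_nhds_iff
      (f := fun q : ι × E => g q.1 q.2)).symm
  induction k generalizing Z with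
  | zero =>
    refine ⟨fun h j hj y hy => ?_, fun h y hy => (h0 g g₀ y).1 (h 0 le_rfl y hy)⟩
    obtain rfl : j = 0 := by omega
    exact (h0 g g₀ y).2 (h y hy)
  | succ k ih =>
    have hs : ∀ j y, Filter.Tendsto (fun q : ι × E => iteratedFDeriv ℝ (j + 1) (g q.1) q.2)
        (l ×ˢ 𝓝 y) (𝓝 (iteratedFDeriv ℝ (j + 1) g₀ y)) ↔
        Filter.Tendsto (fun q : ι × E => iteratedFDeriv ℝ j (fderiv ℝ (g q.1)) q.2)
        (l ×ˢ 𝓝 y) (𝓝 (iteratedFDeriv ℝ j (fderiv ℝ g₀) y)) := by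
      intro j y
      simp only [iteratedFDeriv_succ_eq_comp_right, Function.comp_apply]
      exact (((continuousMultilinearCurryRightEquiv' ℝ j E Z).symm.toHomeomorph.isEmbedding
        ).tendsto_nhds_iff
        (f := fun q : ι × E => iteratedFDeriv ℝ j (fderiv ℝ (g q.1)) q.2)).symm
    have ih' := ih (fun p => (hg p).fderiv_of_isOpen hΩ (m := ∞) (by simp))
      (hg₀.fderiv_of_isOpen hΩ (m := ∞) (by simp))
    constructor
    · intro h j hj y hy
      cases j with
      | zero => exact (h0 g g₀ y).2 (h.1 y hy)
      | succ j => exact (hs j y).2 (ih'.1 h.2.2.2 j (by omega) y hy)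
    · intro h
      exact ⟨fun y hy => (h0 g g₀ y).1 (h 0 (by omega) y hy),
        .of_forall fun p => (hg p).differentiableOn (by simp), hg₀.differentiableOn (by simp),
        ih'.2 fun j hj y hy => (hs j y).1 (h (j + 1) (by omega) y hy)⟩

/-- Locally uniform convergence to a continuous limit is continuous convergence. -/
theorem tendstoLocallyUniformlyOn_iff_tendsto_prod {ι X Y : Type*} [TopologicalSpace X]
    [PseudoMetricSpace Y] {l : Filter ι} {Ω : Set X} (hΩ : IsOpen Ω) {g : ι → X → Y} {g₀ : X → Y}
    (hg₀ : ContinuousOn g₀ Ω) : TendstoLocallyUniformlyOn g g₀ l Ω ↔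
      ∀ y ∈ Ω, Filter.Tendsto (fun q : ι × X => g q.1 q.2) (l ×ˢ 𝓝 y) (𝓝 (g₀ y)) := by
  rw [tendstoLocallyUniformlyOn_iff_filter]
  refine forall₂_congr fun y hy => ?_
  have hc : Filter.Tendsto (fun q : ι × X => g₀ q.2) (l ×ˢ 𝓝 y) (𝓝 (g₀ y)) :=
    ((hg₀.continuousAt (hΩ.mem_nhds hy)).tendsto).comp Filter.tendsto_snd
  rw [hΩ.nhdsWithin_eq hy, Metric.tendstoUniformlyOnFilter_iff]
  constructor
  · intro h
    rw [Metric.tendsto_nhds] at hc ⊢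
    intro ε hε
    filter_upwards [h (ε / 2) (half_pos hε), hc (ε / 2) (half_pos hε)] with q h1 h2
    calc dist (g q.1 q.2) (g₀ y) ≤ dist (g q.1 q.2) (g₀ q.2) + dist (g₀ q.2) (g₀ y) :=
          dist_triangle _ _ _
      _ < ε := by rw [dist_comm (g q.1 q.2)]; linarith
  · intro h ε hε
    rw [Metric.tendsto_nhds] at hc h
    filter_upwards [h (ε / 2) (half_pos hε), hc (ε / 2) (half_pos hε)] with q h1 h2
    calc dist (g₀ q.2) (g q.1 q.2) ≤ dist (g₀ q.2) (g₀ y) + dist (g₀ y) (g q.1 q.2) :=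
          dist_triangle _ _ _
      _ < ε := by rw [dist_comm (g₀ y)]; linarith

end CkConvergence

/-! ### Integrals depending smoothly on a parameter -/

section ParametricIntegral

open scoped Interval

universe u

/-- The parametric integral `z ↦ ∫₀¹ f(s, z) ds` of a function smooth on an open set `W` is
differentiable wherever the segment `[0, 1] × {z}` lies in `W`. -/
theorem hasFDerivAt_parametric_integral {Z G : Type u} [NormedAddCommGroup Z] [NormedSpace ℝ Z]
    [NormedAddCommGroup G] [NormedSpace ℝ G] {W : Set (ℝ × Z)} (hW : IsOpen W)
    {f : ℝ × Z → G} (hf : ContDiffOn ℝ ∞ f W) {z₀ : Z}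
    (hz₀ : ∀ s ∈ Set.Icc (0 : ℝ) 1, (s, z₀) ∈ W) :
    HasFDerivAt (fun z => ∫ s in (0 : ℝ)..1, f (s, z))
      (∫ s in (0 : ℝ)..1, fderiv ℝ f (s, z₀) ∘L ContinuousLinearMap.inr ℝ ℝ Z) z₀ := by
  have hf1 : ContDiffOn ℝ ∞ (fun p => fderiv ℝ f p ∘L ContinuousLinearMap.inr ℝ ℝ Z) W :=
    (hf.fderiv_of_isOpen hW (m := ∞) (by simp)).clm_comp contDiffOn_const
  have hIoc : Ι (0 : ℝ) 1 ⊆ Set.Icc 0 1 := by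
    rw [Set.uIoc_of_le zero_le_one]; exact Set.Ioc_subset_Icc_self
  have hopen : ∀ᶠ z in 𝓝 z₀, ∀ s ∈ Set.Icc (0 : ℝ) 1, (s, z) ∈ W :=
    isCompact_Icc.eventually_forall_of_forall_eventually fun s hs =>
      (continuous_swap.tendsto (z₀, s)).eventually (hW.mem_nhds (hz₀ s hs))
  have hline : ∀ z : Z, ContinuousOn (fun s : ℝ => (s, z)) (Set.Icc 0 1) := fun z =>
    by fun_prop
  have hcont : ∀ {z}, (∀ s ∈ Set.Icc (0 : ℝ) 1, (s, z) ∈ W) →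
      ContinuousOn (fun s => f (s, z)) (Set.Icc 0 1) := fun {z} hz =>
    hf.continuousOn.comp (hline z) hz
  have hcont1 := hf1.continuousOn.comp (hline z₀) hz₀
  obtain ⟨C, hC⟩ := isCompact_Icc.exists_bound_of_continuousOn hcont1
  have hbound : ∀ᶠ z in 𝓝 z₀, ∀ s ∈ Set.Icc (0 : ℝ) 1,
      ‖fderiv ℝ f (s, z) ∘L ContinuousLinearMap.inr ℝ ℝ Z‖ < C + 1 := by
    refine isCompact_Icc.eventually_forall_of_forall_eventually fun s hs => ?_
    have h1 := ((hf1.continuousOn.continuousAt (hW.mem_nhds (hz₀ s hs))).norm).tendsto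
    have h2 := h1.comp (continuous_swap.tendsto (z₀, s))
    exact h2.eventually (gt_mem_nhds (lt_of_le_of_lt (hC s hs) (lt_add_one C)))
  have hmeas : ∀ {H : Type u} [NormedAddCommGroup H] {φ : ℝ → H},
      ContinuousOn φ (Set.Icc 0 1) → MeasureTheory.AEStronglyMeasurable φ
        (MeasureTheory.volume.restrict (Ι (0 : ℝ) 1)) := fun h =>
    (h.mono hIoc).aestronglyMeasurable measurableSet_uIoc
  refine intervalIntegral.hasFDerivAt_integral_of_dominated_of_fderiv_le
    (F := fun z s => f (s, z))
    (F' := fun z s => fderiv ℝ f (s, z) ∘L ContinuousLinearMap.inr ℝ ℝ Z)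
    (bound := fun _ => C + 1) (hopen.and hbound) ?_ ?_ ?_ ?_ ?_ ?_
  · exact hopen.mono fun z hz => hmeas (hcont hz)
  · exact ContinuousOn.intervalIntegrable (by rw [Set.uIcc_of_le zero_le_one]; exact hcont hz₀)
  · exact hmeas hcont1
  · exact .of_forall fun s hs z hz => (hz.2 s (hIoc hs)).le
  · exact intervalIntegrable_const
  · refine .of_forall fun s hs z hz => ?_
    have h1 := ((hf.differentiableOn (by simp)).differentiableAt
      (hW.mem_nhds (hz.1 s (hIoc hs)))).hasFDerivAt
    exact h1.comp z (hasFDerivAt_prodMk_right s z)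

theorem contDiffOn_parametric_integral {Z G : Type u} [NormedAddCommGroup Z] [NormedSpace ℝ Z]
    [NormedAddCommGroup G] [NormedSpace ℝ G] {W : Set (ℝ × Z)} (hW : IsOpen W)
    {f : ℝ × Z → G} (hf : ContDiffOn ℝ ∞ f W) :
    ContDiffOn ℝ ∞ (fun z => ∫ s in (0 : ℝ)..1, f (s, z))
      {z | ∀ s ∈ Set.Icc (0 : ℝ) 1, (s, z) ∈ W} := by
  have hO : IsOpen {z | ∀ s ∈ Set.Icc (0 : ℝ) 1, (s, z) ∈ W} := by
    rw [isOpen_iff_mem_nhds]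
    exact fun z hz => isCompact_Icc.eventually_forall_of_forall_eventually fun s hs =>
      (continuous_swap.tendsto (z, s)).eventually (hW.mem_nhds (hz s hs))
  refine contDiffOn_infty.2 fun k => ?_
  induction k generalizing G with
  | zero =>
    exact contDiffOn_zero.2 fun z hz =>
      (hasFDerivAt_parametric_integral hW hf hz).continuousAt.continuousWithinAt
  | succ k ih =>
    push_cast
    refine (contDiffOn_succ_iff_fderiv_of_isOpen hO).2 ⟨fun z hz =>
      (hasFDerivAt_parametric_integral hW hf hz).differentiableAt.differentiableWithinAt,
      by simp, ?_⟩
    exact (ih ((hf.fderiv_of_isOpen hW (m := ∞) (by simp)).clm_comp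
      (contDiffOn_const (c := ContinuousLinearMap.inr ℝ ℝ Z)))).congr fun z hz =>
        (hasFDerivAt_parametric_integral hW hf hz).fderiv

end ParametricIntegral

/-! ### The exponential and the logarithm relative to a base point -/

section RelativeExp

universe u

variable {A : Type u} [NormedRing A] [NormedAlgebra ℝ A]

/-- The element `H e^{H⁻¹ V}`. For the matrices of forms `h`, `v` it is the matrix of the form
`h e^{h⁻¹ v}`. The matrix of `v` transforms like the one of `h`, which makes this expression the same
in all frames. -/
def formExp (H V : A) : A := H * NormedSpace.exp (Ring.inverse H * V)

/-- The element `H log(H⁻¹ K)`, written with `D = K - H` as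
`∫₀¹ D - s D (H + s D)⁻¹ D ds`. This formula makes sense and is smooth as long as the segment from
`H` to `K` consists of invertible elements. -/
def formLog (H K : A) : A :=
  ∫ s in (0 : ℝ)..1, ((K - H) - s • ((K - H) * Ring.inverse (H + s • (K - H)) * (K - H)))

/-- The segment from `H` to `K` consists of invertible elements. -/
def InvertibleSegment (H K : A) : Prop :=
  ∀ s ∈ Set.Icc (0 : ℝ) 1, IsUnit (H + s • (K - H))

theorem formExp_zero {H : A} : formExp H 0 = H := by
  rw [formExp, mul_zero, NormedSpace.exp_zero, mul_one]

variable [CompleteSpace A]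

theorem contDiffOn_ringInverse : ContDiffOn ℝ ∞ (Ring.inverse : A → A) {X | IsUnit X} := by
  rintro X ⟨u, rfl⟩
  exact (contDiffAt_ringInverse ℝ u).contDiffWithinAt

theorem contDiffOn_formExp : ContDiffOn ℝ ∞ (fun z : A × A => formExp z.1 z.2)
    {z | IsUnit z.1} := by
  have hexp : ContDiff ℝ ∞ (NormedSpace.exp : A → A) :=
    contDiff_iff_contDiffAt.2 fun x => (NormedSpace.exp_analytic (𝕂 := ℝ) x).contDiffAt
  have hinv : ContDiffOn ℝ ∞ (fun z : A × A => Ring.inverse z.1) {z | IsUnit z.1} :=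
    contDiffOn_ringInverse.comp contDiff_fst.contDiffOn fun z hz => hz
  exact contDiff_fst.contDiffOn.mul
    (hexp.comp_contDiffOn (hinv.mul contDiff_snd.contDiffOn))

theorem isOpen_segment_domain : IsOpen {p : ℝ × (A × A) | IsUnit (p.2.1 + p.1 • (p.2.2 - p.2.1))} :=
  Units.isOpen.preimage (by fun_prop)

theorem contDiffOn_formLog_integrand : ContDiffOn ℝ ∞ (fun p : ℝ × (A × A) =>
    (p.2.2 - p.2.1) - p.1 •
      ((p.2.2 - p.2.1) * Ring.inverse (p.2.1 + p.1 • (p.2.2 - p.2.1)) * (p.2.2 - p.2.1)))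
    {p | IsUnit (p.2.1 + p.1 • (p.2.2 - p.2.1))} := by
  have h0 : ContDiff ℝ ∞ (fun p : ℝ × (A × A) => p.2.1 + p.1 • (p.2.2 - p.2.1)) := by fun_prop
  have h1 : ContDiffOn ℝ ∞ (fun p : ℝ × (A × A) =>
      Ring.inverse (p.2.1 + p.1 • (p.2.2 - p.2.1))) {p | IsUnit (p.2.1 + p.1 • (p.2.2 - p.2.1))} :=
    contDiffOn_ringInverse.comp h0.contDiffOn fun p hp => hp
  have h2 : ContDiff ℝ ∞ (fun p : ℝ × (A × A) => p.2.2 - p.2.1) := by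
    fun_prop
  exact h2.contDiffOn.sub (contDiff_fst.contDiffOn.smul
    ((h2.contDiffOn.mul h1).mul h2.contDiffOn))

theorem contDiffOn_formLog : ContDiffOn ℝ ∞ (fun z : A × A => formLog z.1 z.2)
    {z | InvertibleSegment z.1 z.2} :=
  contDiffOn_parametric_integral (Z := A × A) (G := A) (isOpen_segment_domain (A := A))
    (contDiffOn_formLog_integrand (A := A))

theorem isOpen_invertibleSegment : IsOpen {z : A × A | InvertibleSegment z.1 z.2} := by
  rw [isOpen_iff_mem_nhds]
  exact fun z hz => isCompact_Icc.eventually_forall_of_forall_eventually fun s hs =>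
    (continuous_swap.tendsto (z, s)).eventually (isOpen_segment_domain.mem_nhds (hz s hs))

theorem continuousOn_formLog_integrand {H K : A} (hHK : InvertibleSegment H K) :
    ContinuousOn (fun s : ℝ => (K - H) - s • ((K - H) * Ring.inverse (H + s • (K - H)) * (K - H)))
      (Set.uIcc 0 1) := by
  rw [Set.uIcc_of_le zero_le_one]
  have h1 : ContinuousOn (fun s : ℝ => Ring.inverse (H + s • (K - H))) (Set.Icc 0 1) :=
    contDiffOn_ringInverse.continuousOn.comp (by fun_prop) hHK
  fun_prop

theorem HasDerivAt.ringInverse {P : ℝ → A} {P' : A} {t : ℝ} (h : HasDerivAt P P' t)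
    (hu : IsUnit (P t)) : HasDerivAt (fun s => Ring.inverse (P s))
      (-(Ring.inverse (P t) * P' * Ring.inverse (P t))) t := by
  obtain ⟨u, hu⟩ := hu
  have h1 := hasFDerivAt_ringInverse (𝕜 := ℝ) u
  rw [hu] at h1
  exact (h1.comp_hasDerivAt t h).congr_deriv (by simp [← hu])

end RelativeExp

/-! ### Matrices of Hermitian forms: the exponential and the logarithm relative to a metric -/

section MatrixForms

open scoped Matrix Matrix.Norms.Operator ComplexOrder

variable {m : Type} [Fintype m] [DecidableEq m]

/-- A positive definite and a Hermitian form are diagonalized by a common congruence. -/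
theorem Matrix.PosDef.exists_simultaneous_diagonal {H V : Matrix m m ℂ} (hH : H.PosDef)
    (hV : V.IsHermitian) : ∃ (P : Matrix m m ℂ) (d : m → ℝ), IsUnit P ∧ H = P * Pᴴ ∧
      V = P * Matrix.diagonal (fun i => (d i : ℂ)) * Pᴴ := by
  have unit_unitary : ∀ U : Matrix.unitaryGroup m ℂ, IsUnit (U : Matrix m m ℂ) := fun U =>
    ⟨Unitary.toUnits U, rfl⟩
  obtain ⟨B, hB, hHB⟩ : ∃ B : Matrix m m ℂ, IsUnit B ∧ H = B * Bᴴ := by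
    have hs := hH.1.spectral_theorem
    rw [Unitary.conjStarAlgAut_apply] at hs
    set U := hH.1.eigenvectorUnitary
    set D := Matrix.diagonal (fun i => ((√(hH.1.eigenvalues i) : ℝ) : ℂ))
    have hD : D * Dᴴ = Matrix.diagonal (RCLike.ofReal ∘ hH.1.eigenvalues) := by
      rw [Matrix.diagonal_conjTranspose, Matrix.diagonal_mul_diagonal]
      congr 1
      ext i
      have := Real.mul_self_sqrt (hH.eigenvalues_pos i).le
      have h2 : ((√(hH.1.eigenvalues i) : ℝ) : ℂ) * (√(hH.1.eigenvalues i) : ℝ) =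
          (hH.1.eigenvalues i : ℂ) := by exact_mod_cast this
      exact (congrArg (_ * ·) (Complex.conj_ofReal _)).trans h2
    refine ⟨U * D, (unit_unitary U).mul ?_, ?_⟩
    · rw [Matrix.isUnit_iff_isUnit_det, Matrix.det_diagonal, isUnit_iff_ne_zero]
      exact Finset.prod_ne_zero_iff.2 fun i _ => by
        exact_mod_cast (Real.sqrt_pos.2 (hH.eigenvalues_pos i)).ne'
    · rw [Matrix.conjTranspose_mul, hs, ← hD]
      simp only [Matrix.star_eq_conjTranspose, Matrix.mul_assoc]
  have hBd := (Matrix.isUnit_iff_isUnit_det _).1 hB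
  have hBd' : IsUnit (Bᴴ).det := by rw [Matrix.det_conjTranspose]; exact hBd.star
  have hX : (B⁻¹ * V * (B⁻¹)ᴴ).IsHermitian := Matrix.isHermitian_mul_mul_conjTranspose _ hV
  obtain ⟨U, d, hs⟩ : ∃ (U : Matrix.unitaryGroup m ℂ) (d : m → ℝ), B⁻¹ * V * (B⁻¹)ᴴ =
      U * Matrix.diagonal (fun i => (d i : ℂ)) * star (U : Matrix m m ℂ) :=
    ⟨hX.eigenvectorUnitary, hX.eigenvalues, by
      have hs := hX.spectral_theorem
      rwa [Unitary.conjStarAlgAut_apply] at hs⟩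
  refine ⟨B * U, d, hB.mul (unit_unitary U), ?_, ?_⟩
  · have hU : (U : Matrix m m ℂ) * (U : Matrix m m ℂ)ᴴ = 1 := Unitary.coe_mul_star_self U
    rw [Matrix.conjTranspose_mul, Matrix.mul_assoc, ← Matrix.mul_assoc _ _ Bᴴ, hU, Matrix.one_mul,
      hHB]
  · have h1 : V = B * (B⁻¹ * V * (B⁻¹)ᴴ) * Bᴴ := by
      rw [Matrix.conjTranspose_nonsing_inv]
      simp only [Matrix.mul_assoc]
      rw [Matrix.nonsing_inv_mul _ hBd', Matrix.mul_nonsing_inv_cancel_left _ _ hBd, Matrix.mul_one]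
    have h2 := congrArg (fun X => B * X * Bᴴ) hs
    beta_reduce at h2
    rw [← h1] at h2
    refine h2.trans ?_
    rw [Matrix.conjTranspose_mul]
    simp only [Matrix.star_eq_conjTranspose, Matrix.mul_assoc]

/-- The symmetries of the space of matrices under which the matrix of a sesquilinear form is
natural: the congruences `X ↦ P X Pᴴ`, which express a change of frame, and `X ↦ Xᴴ`, whose fixed
points are the Hermitian forms. -/
def IsFormSymmetry (T : Matrix m m ℂ →L[ℝ] Matrix m m ℂ) : Prop :=
  (∃ P : Matrix m m ℂ, IsUnit P ∧ ∀ X, T X = P * X * Pᴴ) ∨ ∀ X, T X = Xᴴ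

/-- The congruence `X ↦ P X Pᴴ`. -/
def congruence (P : Matrix m m ℂ) : Matrix m m ℂ →L[ℝ] Matrix m m ℂ :=
  LinearMap.toContinuousLinearMap
    { toFun := fun X => P * X * Pᴴ
      map_add' := fun X Y => by rw [Matrix.mul_add, Matrix.add_mul]
      map_smul' := fun c X => by simp }

theorem isFormSymmetry_congruence {P : Matrix m m ℂ} (hP : IsUnit P) :
    IsFormSymmetry (congruence P) := Or.inl ⟨P, hP, fun _ => rfl⟩

/-- The conjugate transpose, as a real linear map. -/
def conjTransposeL : Matrix m m ℂ →L[ℝ] Matrix m m ℂ :=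
  LinearMap.toContinuousLinearMap
    { toFun := fun X => Xᴴ
      map_add' := fun X Y => Matrix.conjTranspose_add X Y
      map_smul' := fun c X => by simp }

theorem isFormSymmetry_conjTransposeL : IsFormSymmetry (conjTransposeL (m := m)) :=
  Or.inr fun _ => rfl

namespace IsFormSymmetry

variable {T : Matrix m m ℂ →L[ℝ] Matrix m m ℂ}

theorem isUnit (hT : IsFormSymmetry T) {X : Matrix m m ℂ} (hX : IsUnit X) : IsUnit (T X) := by
  obtain ⟨P, hP, h⟩ | h := hT
  · rw [h]; exact (hP.mul hX).mul hP.star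
  · rw [h]; exact hX.star

/-- `D ↦ D N⁻¹ D` commutes with the symmetries. -/
theorem mul_inv_mul (hT : IsFormSymmetry T) (D N : Matrix m m ℂ) :
    T (D * N⁻¹ * D) = T D * (T N)⁻¹ * T D := by
  obtain ⟨P, hP, h⟩ | h := hT
  · have hP1 := (Matrix.isUnit_iff_isUnit_det _).1 hP
    have hP2 : IsUnit (Pᴴ).det := by rw [Matrix.det_conjTranspose]; exact hP1.star
    simp only [h, Matrix.mul_inv_rev, Matrix.mul_assoc]
    rw [Matrix.mul_nonsing_inv_cancel_left _ _ hP2, Matrix.nonsing_inv_mul_cancel_left _ _ hP1]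
  · simp only [h, Matrix.conjTranspose_mul, Matrix.conjTranspose_nonsing_inv, Matrix.mul_assoc]

end IsFormSymmetry

theorem formExp_eq (H V : Matrix m m ℂ) : formExp H V = H * NormedSpace.exp (H⁻¹ * V) := by
  rw [formExp, Matrix.nonsing_inv_eq_ringInverse]
  rfl

theorem formExp_symmetry {T : Matrix m m ℂ →L[ℝ] Matrix m m ℂ} (hT : IsFormSymmetry T)
    {H : Matrix m m ℂ} (hH : IsUnit H) (V : Matrix m m ℂ) :
    formExp (T H) (T V) = T (formExp H V) := by
  have hH1 := (Matrix.isUnit_iff_isUnit_det _).1 hH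
  obtain ⟨P, hP, h⟩ | h := hT
  · have hP1 := (Matrix.isUnit_iff_isUnit_det _).1 hP
    have hP2 : IsUnit (Pᴴ).det := by rw [Matrix.det_conjTranspose]; exact hP1.star
    have h1 : (P * H * Pᴴ)⁻¹ * (P * V * Pᴴ) = (Pᴴ)⁻¹ * (H⁻¹ * V) * Pᴴ := by
      simp only [Matrix.mul_inv_rev, Matrix.mul_assoc]
      rw [Matrix.nonsing_inv_mul_cancel_left _ _ hP1]
    rw [h, h, h, formExp_eq, formExp_eq, h1, Matrix.exp_conj' Pᴴ _ hP.star]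
    simp only [Matrix.mul_assoc]
    rw [Matrix.mul_nonsing_inv_cancel_left _ _ hP2]
  · have h1 : H * (H⁻¹ * V) * H⁻¹ = V * H⁻¹ := by
      rw [Matrix.mul_nonsing_inv_cancel_left _ _ hH1]
    rw [h, h, h, formExp_eq, formExp_eq, Matrix.conjTranspose_mul, ← Matrix.exp_conjTranspose,
      Matrix.conjTranspose_mul, Matrix.conjTranspose_nonsing_inv]
    have hH2 : IsUnit (Hᴴ).det := by rw [Matrix.det_conjTranspose]; exact hH1.star
    have h2 : Vᴴ * (Hᴴ)⁻¹ = Hᴴ * ((Hᴴ)⁻¹ * Vᴴ) * (Hᴴ)⁻¹ := by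
      rw [Matrix.mul_nonsing_inv_cancel_left _ _ hH2]
    rw [h2, Matrix.exp_conj Hᴴ _ hH.star]
    simp only [Matrix.mul_assoc]
    rw [Matrix.nonsing_inv_mul _ hH2, Matrix.mul_one]

theorem formLog_symmetry {T : Matrix m m ℂ →L[ℝ] Matrix m m ℂ} (hT : IsFormSymmetry T)
    {H K : Matrix m m ℂ} (hHK : InvertibleSegment H K) :
    formLog (T H) (T K) = T (formLog H K) := by
  refine Eq.trans ?_ (T.intervalIntegral_comp_comm (μ := MeasureTheory.volume)
    (continuousOn_formLog_integrand hHK).intervalIntegrable)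
  rw [formLog]
  congr 1
  ext1 s
  simp only [← Matrix.nonsing_inv_eq_ringInverse]
  have h1 : T H + s • (T K - T H) = T (H + s • (K - H)) := by simp
  rw [h1, ← map_sub T K H, ← hT.mul_inv_mul, ← map_smul, ← map_sub]
  rfl

theorem Matrix.PosDef.invertibleSegment {H K : Matrix m m ℂ} (hH : H.PosDef) (hK : K.PosDef) :
    InvertibleSegment H K := by
  intro s hs
  have h1 : H + s • (K - H) = (1 - s) • H + s • K := by
    rw [smul_sub, sub_smul, one_smul]; abel
  rw [h1]
  obtain h0 | h0 := hs.1.eq_or_lt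
  · simpa [← h0] using hH.isUnit
  · exact (Matrix.PosDef.posSemidef_add (hH.posSemidef.smul (sub_nonneg.2 hs.2))
      (hK.smul h0)).isUnit

theorem posDef_diagonal_congruence {P : Matrix m m ℂ} (hP : IsUnit P) {d : m → ℝ}
    (hd : ∀ i, 0 < d i) : (P * Matrix.diagonal (fun i => (d i : ℂ)) * Pᴴ).PosDef :=
  (Matrix.IsUnit.posDef_star_right_conjugate_iff hP).2
    (Matrix.posDef_diagonal_iff.2 fun i => by exact_mod_cast hd i)

theorem pos_of_posDef_diagonal_congruence {P : Matrix m m ℂ} (hP : IsUnit P) {d : m → ℝ}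
    (h : (P * Matrix.diagonal (fun i => (d i : ℂ)) * Pᴴ).PosDef) (i : m) : 0 < d i := by
  have := Matrix.posDef_diagonal_iff.1 ((Matrix.IsUnit.posDef_star_right_conjugate_iff hP).1 h) i
  exact_mod_cast this

theorem formExp_diagonal {P : Matrix m m ℂ} (hP : IsUnit P) (d : m → ℝ) :
    formExp (P * Pᴴ) (P * Matrix.diagonal (fun i => (d i : ℂ)) * Pᴴ) =
      P * Matrix.diagonal (fun i => (Real.exp (d i) : ℂ)) * Pᴴ := by
  have h := formExp_symmetry (isFormSymmetry_congruence hP) isUnit_one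
    (Matrix.diagonal (fun i => (d i : ℂ)))
  have h1 : congruence P 1 = P * Pᴴ := by simp [congruence]
  rw [h1] at h
  refine h.trans ?_
  have h2 : formExp 1 (Matrix.diagonal (fun i => (d i : ℂ))) =
      Matrix.diagonal (fun i => (Real.exp (d i) : ℂ)) := by
    rw [formExp_eq, inv_one, Matrix.one_mul, Matrix.one_mul, Matrix.exp_diagonal]
    congr 1
    ext i
    rw [Pi.coe_exp, ← Complex.exp_eq_exp_ℂ, Complex.ofReal_exp]
  rw [h2]
  rfl

theorem one_add_mul_pos {κ s : ℝ} (hκ : 0 < κ) (hs : s ∈ Set.uIcc (0 : ℝ) 1) :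
    0 < 1 + s * (κ - 1) := by
  rw [Set.uIcc_of_le zero_le_one] at hs
  have h1 : 1 + s * (κ - 1) = (1 - s) + s * κ := by ring
  rw [h1]
  obtain h0 | h0 := hs.1.eq_or_lt
  · simp [← h0]
  · have := mul_pos h0 hκ
    linarith [hs.2]

theorem integral_eq_log_segment {κ : ℝ} (hκ : 0 < κ) :
    ∫ s in (0 : ℝ)..1, ((κ - 1) - s * ((κ - 1) * (1 + s * (κ - 1))⁻¹ * (κ - 1))) = Real.log κ := by
  have hpos := fun s (hs : s ∈ Set.uIcc (0 : ℝ) 1) => one_add_mul_pos hκ hs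
  have hder : ∀ s ∈ Set.uIcc (0 : ℝ) 1, HasDerivAt (fun s => Real.log (1 + s * (κ - 1)))
      ((κ - 1) - s * ((κ - 1) * (1 + s * (κ - 1))⁻¹ * (κ - 1))) s := by
    intro s hs
    have h1 : HasDerivAt (fun s : ℝ => 1 + s * (κ - 1)) (κ - 1) s := by
      simpa using ((hasDerivAt_id s).mul_const (κ - 1)).const_add 1
    convert h1.log (hpos s hs).ne' using 1
    have h2 := mul_inv_cancel₀ (hpos s hs).ne'
    rw [div_eq_mul_inv]
    linear_combination -(κ - 1) * h2
  rw [intervalIntegral.integral_eq_sub_of_hasDerivAt hder]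
  · simp
  · refine ContinuousOn.intervalIntegrable ?_
    have : ContinuousOn (fun s : ℝ => (1 + s * (κ - 1))⁻¹) (Set.uIcc 0 1) :=
      ContinuousOn.inv₀ (by fun_prop) fun s hs => (hpos s hs).ne'
    fun_prop

theorem formLog_diagonal {P : Matrix m m ℂ} (hP : IsUnit P) {κ : m → ℝ} (hκ : ∀ i, 0 < κ i) :
    formLog (P * Pᴴ) (P * Matrix.diagonal (fun i => (κ i : ℂ)) * Pᴴ) =
      P * Matrix.diagonal (fun i => (Real.log (κ i) : ℂ)) * Pᴴ := by
  have hpd : (Matrix.diagonal (fun i => (κ i : ℂ))).PosDef :=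
    Matrix.posDef_diagonal_iff.2 fun i => by exact_mod_cast hκ i
  have h := formLog_symmetry (isFormSymmetry_congruence hP) (Matrix.PosDef.one.invertibleSegment hpd)
  have h1 : congruence P 1 = P * Pᴴ := by simp [congruence]
  rw [h1] at h
  refine h.trans ?_
  suffices h2 : formLog 1 (Matrix.diagonal (fun i => (κ i : ℂ))) =
      Matrix.diagonal (fun i => (Real.log (κ i) : ℂ)) by rw [h2]; rfl
  -- the integrand is the diagonal matrix with the scalar integrands as entries
  let D : (m → ℝ) →L[ℝ] Matrix m m ℂ := LinearMap.toContinuousLinearMap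
    { toFun := fun d => Matrix.diagonal (fun i => (d i : ℂ))
      map_add' := fun a b => by simp [Matrix.diagonal_add]
      map_smul' := fun c a => by
        rw [← Matrix.diagonal_smul]; congr 1; ext i; simp }
  let φ : ℝ → m → ℝ := fun s i =>
    (κ i - 1) - s * ((κ i - 1) * (1 + s * (κ i - 1))⁻¹ * (κ i - 1))
  have hφ : ContinuousOn φ (Set.uIcc 0 1) := by
    refine continuousOn_pi.2 fun i => ?_
    have : ContinuousOn (fun s : ℝ => (1 + s * (κ i - 1))⁻¹) (Set.uIcc 0 1) :=
      ContinuousOn.inv₀ (by fun_prop) fun s hs => (one_add_mul_pos (hκ i) hs).ne'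
    fun_prop
  have hint : formLog 1 (Matrix.diagonal (fun i => (κ i : ℂ))) = ∫ s in (0 : ℝ)..1, D (φ s) := by
    rw [formLog]
    refine intervalIntegral.integral_congr fun s hs => ?_
    have h2 : Matrix.diagonal (fun i => (κ i : ℂ)) - 1 = D (fun i => κ i - 1) := by
      rw [← Matrix.diagonal_one, Matrix.diagonal_sub]
      change _ = Matrix.diagonal _
      congr 1; ext i; simp
    have h3 : 1 + s • D (fun i => κ i - 1) = D (fun i => 1 + s * (κ i - 1)) := by
      rw [← map_smul]
      have : (1 : Matrix m m ℂ) = D 1 := by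
        rw [← Matrix.diagonal_one]
        change _ = Matrix.diagonal _
        congr 1
      rw [this, ← map_add]
      rfl
    have hmul : ∀ a b : m → ℝ, D a * D b = D (a * b) := fun a b => by
      change Matrix.diagonal _ * Matrix.diagonal _ = Matrix.diagonal _
      rw [Matrix.diagonal_mul_diagonal]
      congr 1; ext i; simp
    have h4 : Ring.inverse (D (fun i => 1 + s * (κ i - 1))) =
        D (fun i => (1 + s * (κ i - 1))⁻¹) := by
      rw [← Matrix.nonsing_inv_eq_ringInverse]
      refine Matrix.inv_eq_right_inv ?_
      rw [hmul]
      change Matrix.diagonal _ = _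
      rw [← Matrix.diagonal_one]
      congr 1; ext i
      have := mul_inv_cancel₀ (one_add_mul_pos (hκ i) hs).ne'
      simp only [Pi.mul_apply, this, Complex.ofReal_one]
    rw [h2, h3, h4, hmul, hmul, ← map_smul, ← map_sub]
    rfl
  rw [hint]
  refine (D.intervalIntegral_comp_comm hφ.intervalIntegrable).trans ?_
  change Matrix.diagonal _ = Matrix.diagonal _
  congr 1
  ext i
  rw [← integral_eq_log_segment (hκ i)]
  congr 1
  exact ((ContinuousLinearMap.proj (R := ℝ) (φ := fun _ : m => ℝ) i).intervalIntegral_comp_comm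
    hφ.intervalIntegrable).symm

theorem formExp_formLog {H K : Matrix m m ℂ} (hH : H.PosDef) (hK : K.PosDef) :
    formExp H (formLog H K) = K := by
  obtain ⟨P, d, hP, rfl, rfl⟩ := hH.exists_simultaneous_diagonal hK.1
  have hd := pos_of_posDef_diagonal_congruence hP hK
  rw [formLog_diagonal hP hd, formExp_diagonal hP]
  simp only [Real.exp_log (hd _)]

theorem formLog_formExp {H V : Matrix m m ℂ} (hH : H.PosDef) (hV : V.IsHermitian) :
    formLog H (formExp H V) = V := by
  obtain ⟨P, d, hP, rfl, rfl⟩ := hH.exists_simultaneous_diagonal hV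
  rw [formExp_diagonal hP, formLog_diagonal hP fun i => Real.exp_pos _]
  simp only [Real.log_exp]

theorem posDef_formExp {H V : Matrix m m ℂ} (hH : H.PosDef) (hV : V.IsHermitian) :
    (formExp H V).PosDef := by
  obtain ⟨P, d, hP, rfl, rfl⟩ := hH.exists_simultaneous_diagonal hV
  rw [formExp_diagonal hP]
  exact posDef_diagonal_congruence hP fun i => Real.exp_pos _

/-- Positivity of the metric on one fibre: in a basis that diagonalizes `H` and `V` the quadratic
form is `∑ dᵢ² + a (∑ dᵢ)²`, and `(∑ dᵢ)² ≤ r ∑ dᵢ²`. -/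
theorem trace_form_pos {H V : Matrix m m ℂ} (hH : H.PosDef) (hV : V.IsHermitian) {a : ℝ}
    (ha : -1 < (Fintype.card m : ℝ) * a) :
    0 ≤ (Matrix.trace (H⁻¹ * V * (H⁻¹ * V)) +
      (a : ℂ) * Matrix.trace (H⁻¹ * V) * Matrix.trace (H⁻¹ * V)).re ∧
    ((Matrix.trace (H⁻¹ * V * (H⁻¹ * V)) +
      (a : ℂ) * Matrix.trace (H⁻¹ * V) * Matrix.trace (H⁻¹ * V)).re = 0 → V = 0) := by
  obtain ⟨P, d, hP, rfl, rfl⟩ := hH.exists_simultaneous_diagonal hV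
  have hP1 := (Matrix.isUnit_iff_isUnit_det _).1 hP
  have hP2 : IsUnit (Pᴴ).det := by rw [Matrix.det_conjTranspose]; exact hP1.star
  set D := Matrix.diagonal (fun i => (d i : ℂ))
  have h1 : (P * Pᴴ)⁻¹ * (P * D * Pᴴ) = (Pᴴ)⁻¹ * D * Pᴴ := by
    simp only [Matrix.mul_inv_rev, Matrix.mul_assoc]
    rw [Matrix.nonsing_inv_mul_cancel_left _ _ hP1]
  have h2 : (Pᴴ)⁻¹ * D * Pᴴ * ((Pᴴ)⁻¹ * D * Pᴴ) = (Pᴴ)⁻¹ * (D * D) * Pᴴ := by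
    simp only [Matrix.mul_assoc]
    rw [Matrix.mul_nonsing_inv_cancel_left _ _ hP2]
  have h3 : ∀ X : Matrix m m ℂ, Matrix.trace ((Pᴴ)⁻¹ * X * Pᴴ) = X.trace := fun X => by
    rw [Matrix.trace_mul_cycle, Matrix.mul_nonsing_inv _ hP2, Matrix.one_mul]
  have h4 : (Matrix.trace ((P * Pᴴ)⁻¹ * (P * D * Pᴴ) * ((P * Pᴴ)⁻¹ * (P * D * Pᴴ))) +
      (a : ℂ) * Matrix.trace ((P * Pᴴ)⁻¹ * (P * D * Pᴴ)) *
        Matrix.trace ((P * Pᴴ)⁻¹ * (P * D * Pᴴ))).re = ∑ i, d i ^ 2 + a * (∑ i, d i) ^ 2 := by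
    have : (Matrix.trace (D * D) + (a : ℂ) * D.trace * D.trace) =
        ((∑ i, d i ^ 2 + a * (∑ i, d i) ^ 2 : ℝ) : ℂ) := by
      simp only [D, Matrix.diagonal_mul_diagonal, Matrix.trace_diagonal]
      push_cast
      simp only [pow_two, mul_assoc]
    rw [h1, h2, h3, h3, this, Complex.ofReal_re]
  rw [h4]
  have hcs : (∑ i, d i) ^ 2 ≤ (Fintype.card m : ℝ) * ∑ i, d i ^ 2 := by
    simpa using sq_sum_le_card_mul_sum_sq (s := Finset.univ) (f := d)
  have hS : 0 ≤ ∑ i, d i ^ 2 := Finset.sum_nonneg fun i _ => sq_nonneg _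
  have hle : ∃ c : ℝ, 0 < c ∧ c * ∑ i, d i ^ 2 ≤ ∑ i, d i ^ 2 + a * (∑ i, d i) ^ 2 := by
    obtain h | h := le_total 0 a
    · exact ⟨1, one_pos, by nlinarith [mul_nonneg h (sq_nonneg (∑ i, d i))]⟩
    · exact ⟨1 + Fintype.card m * a, by linarith, by nlinarith⟩
  obtain ⟨c, hc, hle⟩ := hle
  refine ⟨(mul_nonneg hc.le hS).trans hle, fun h0 => ?_⟩
  have h5 : ∑ i, d i ^ 2 = 0 := by
    have : c * ∑ i, d i ^ 2 ≤ 0 := hle.trans h0.le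
    nlinarith
  have h6 : ∀ i, d i = 0 := fun i => by
    simpa using (Finset.sum_eq_zero_iff_of_nonneg fun i _ => sq_nonneg (d i)).1 h5 i
      (Finset.mem_univ i)
  have h7 : D = 0 := by simp [D, h6]
  rw [h7, Matrix.mul_zero, Matrix.zero_mul]

end MatrixForms

/-! ### Iterated derivatives of an operation in its second argument -/

section IteratedOperation

variable {X : Type} [NormedAddCommGroup X] [NormedSpace ℝ X]

/-- The `k`-th derivative `D_{w_k} ⋯ D_{w_1} Φ(a, b)` of `Φ` in the second argument `b`, as a
function of `(w_1, …, w_k; a, b)`. The arguments are indexed by `Fin k ⊕ Bool`: `Sum.inr false`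
stands for `a`, and `Sum.inr true` for `b`. -/
def iterOp (Φ : X × X → X) : (k : ℕ) → ((Fin k ⊕ Bool) → X) → X
  | 0, z => Φ (z (Sum.inr false), z (Sum.inr true))
  | k + 1, z => fderiv ℝ (iterOp Φ k) (fun i => z (Sum.map Fin.castSucc id i))
      (Pi.single (Sum.inr true) (z (Sum.inl (Fin.last k))))

/-- The arguments `(w_1, …, w_k; a, b)` with `(a, b) ∈ O`. -/
def opDomain (O : Set (X × X)) (k : ℕ) : Set ((Fin k ⊕ Bool) → X) :=
  {z | (z (Sum.inr false), z (Sum.inr true)) ∈ O}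

theorem isOpen_opDomain {O : Set (X × X)} (hO : IsOpen O) (k : ℕ) : IsOpen (opDomain O k) :=
  hO.preimage (by fun_prop)

theorem contDiffOn_iterOp {O : Set (X × X)} (hO : IsOpen O) {Φ : X × X → X}
    (hΦ : ContDiffOn ℝ ∞ Φ O) (k : ℕ) : ContDiffOn ℝ ∞ (iterOp Φ k) (opDomain O k) := by
  induction k with
  | zero =>
    exact hΦ.comp (t := O) (f := fun z : (Fin 0 ⊕ Bool) → X =>
      (z (Sum.inr false), z (Sum.inr true))) (by fun_prop) fun z hz => hz
  | succ k ih =>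
    have h1 : ContDiffOn ℝ ∞ (fun z : (Fin (k + 1) ⊕ Bool) → X =>
        fderiv ℝ (iterOp Φ k) (fun i => z (Sum.map Fin.castSucc id i))) (opDomain O (k + 1)) :=
      (ih.fderiv_of_isOpen (isOpen_opDomain hO k) (m := ∞) (by simp)).comp
        (f := fun (z : (Fin (k + 1) ⊕ Bool) → X) i => z (Sum.map Fin.castSucc id i))
        (by fun_prop) fun z hz => hz
    have h2 : ContDiff ℝ ∞ (fun z : (Fin (k + 1) ⊕ Bool) → X =>
        (Pi.single (Sum.inr true) (z (Sum.inl (Fin.last k))) : (Fin k ⊕ Bool) → X)) :=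
      (ContinuousLinearMap.single ℝ (fun _ : Fin k ⊕ Bool => X) (Sum.inr true)).contDiff.comp
        (contDiff_apply ℝ X (Sum.inl (Fin.last k)))
    exact h1.clm_apply h2.contDiffOn

/-- If `Φ` commutes with the linear map `T`, so do its iterated derivatives. -/
theorem iterOp_symmetry {O : Set (X × X)} (hO : IsOpen O) {Φ : X × X → X}
    (hΦ : ContDiffOn ℝ ∞ Φ O) {T : X →L[ℝ] X} (hT : ∀ z ∈ O, (T z.1, T z.2) ∈ O)
    (hTΦ : ∀ z ∈ O, Φ (T z.1, T z.2) = T (Φ z)) (k : ℕ) {z : (Fin k ⊕ Bool) → X}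
    (hz : z ∈ opDomain O k) : iterOp Φ k (fun i => T (z i)) = T (iterOp Φ k z) := by
  induction k with
  | zero => exact hTΦ _ hz
  | succ k ih =>
    set z' : (Fin k ⊕ Bool) → X := fun i => z (Sum.map Fin.castSucc id i)
    have hz' : z' ∈ opDomain O k := hz
    have hTz' : (fun i => T (z' i)) ∈ opDomain O k := hT _ hz
    let L : ((Fin k ⊕ Bool) → X) →L[ℝ] ((Fin k ⊕ Bool) → X) :=
      ContinuousLinearMap.pi fun i => T ∘L ContinuousLinearMap.proj i
    have hd : ∀ {y}, y ∈ opDomain O k → HasFDerivAt (iterOp Φ k) (fderiv ℝ (iterOp Φ k) y) y :=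
      fun hy => (((contDiffOn_iterOp hO hΦ k).differentiableOn (by simp)).differentiableAt
        ((isOpen_opDomain hO k).mem_nhds hy)).hasFDerivAt
    have h1 : HasFDerivAt (fun y => iterOp Φ k (L y)) _ z' :=
      (hd (y := L z') hTz').comp z' L.hasFDerivAt
    have h2 : HasFDerivAt (fun y => T (iterOp Φ k y)) _ z' := T.hasFDerivAt.comp z' (hd hz')
    have h3 : (fun y => iterOp Φ k (L y)) =ᶠ[𝓝 z'] fun y => T (iterOp Φ k y) := by
      filter_upwards [(isOpen_opDomain hO k).mem_nhds hz'] with y hy using ih hy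
    have h4 := (h1.congr_of_eventuallyEq h3.symm).unique h2
    have h5 : (Pi.single (Sum.inr true) (T (z (Sum.inl (Fin.last k)))) : (Fin k ⊕ Bool) → X) =
        L (Pi.single (Sum.inr true) (z (Sum.inl (Fin.last k)))) := by
      ext1 i
      change _ = T _
      by_cases h : i = Sum.inr true
      · subst h; simp
      · simp [h]
    have h6 := congrArg
      (fun A => A (Pi.single (Sum.inr true) (z (Sum.inl (Fin.last k))))) h4
    change fderiv ℝ (iterOp Φ k) (L z') (Pi.single _ (T _)) = _
    rw [h5]
    exact h6

end IteratedOperation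

/-! ### The matrix of a sesquilinear form in a basis -/

section FormMatrix

open scoped Matrix ComplexOrder

variable {V : Type*} [AddCommGroup V] [Module ℂ V] {m : Type} [Fintype m] [DecidableEq m]

/-- The matrix `(s(e_i, e_j))` of a sesquilinear form in a basis. -/
def formMatrix (e : Module.Basis m ℂ V) (s : V →ₗ[ℂ] V →ₗ⋆[ℂ] ℂ) : Matrix m m ℂ :=
  Matrix.of fun i j => s (e i) (e j)

theorem form_eq_sum (e : Module.Basis m ℂ V) (s : V →ₗ[ℂ] V →ₗ⋆[ℂ] ℂ) (a b : V) :
    s a b = ∑ i, ∑ j, e.repr a i * star (e.repr b j) * formMatrix e s i j := by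
  conv_lhs => rw [← e.sum_repr a, ← e.sum_repr b]
  simp [-Module.Basis.sum_repr, formMatrix, Finset.mul_sum, mul_assoc]
  rw [Finset.sum_comm]
  exact Finset.sum_congr rfl fun i _ => Finset.sum_congr rfl fun j _ => mul_left_comm _ _ _

theorem formMatrix_injective (e : Module.Basis m ℂ V) {s t : V →ₗ[ℂ] V →ₗ⋆[ℂ] ℂ}
    (h : formMatrix e s = formMatrix e t) : s = t := by
  ext a b
  rw [form_eq_sum e s, form_eq_sum e t, h]

/-- The sesquilinear form with a given matrix. -/
def formOfMatrix (e : Module.Basis m ℂ V) (A : Matrix m m ℂ) : V →ₗ[ℂ] V →ₗ⋆[ℂ] ℂ :=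
  LinearMap.mk₂'ₛₗ (RingHom.id ℂ) (starRingEnd ℂ)
    (fun a b => ∑ i, ∑ j, e.repr a i * star (e.repr b j) * A i j)
    (fun a a' b => by simp [add_mul, Finset.sum_add_distrib])
    (fun c a b => by simp [mul_assoc, Finset.mul_sum])
    (fun a b b' => by simp [add_mul, mul_add, Finset.sum_add_distrib])
    (fun c a b => by
      simp only [map_smul, Finsupp.smul_apply, smul_eq_mul, star_mul', Finset.mul_sum]
      refine Finset.sum_congr rfl fun i _ => Finset.sum_congr rfl fun j _ => ?_
      simp only [starRingEnd_apply]
      ring)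

theorem formMatrix_formOfMatrix (e : Module.Basis m ℂ V) (A : Matrix m m ℂ) :
    formMatrix e (formOfMatrix e A) = A := by
  ext i j
  simp [formMatrix, formOfMatrix, Finsupp.single_apply, Finset.sum_ite_eq]

/-- A change of basis acts on the matrices of all forms by one and the same congruence. -/
theorem exists_congruence (e e' : Module.Basis m ℂ V) :
    ∃ P : Matrix m m ℂ, IsUnit P ∧ ∀ s, formMatrix e s = P * formMatrix e' s * Pᴴ := by
  refine ⟨(e'.toMatrix e)ᵀ, ?_, fun s => ?_⟩
  · rw [Matrix.isUnit_transpose]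
    exact ⟨⟨e'.toMatrix e, e.toMatrix e', e'.toMatrix_mul_toMatrix_flip e,
      e.toMatrix_mul_toMatrix_flip e'⟩, rfl⟩
  · ext i j
    change s (e i) (e j) = _
    rw [form_eq_sum e' s]
    simp only [Matrix.mul_apply, Matrix.conjTranspose_apply, Matrix.transpose_apply,
      Module.Basis.toMatrix_apply, Finset.sum_mul]
    rw [Finset.sum_comm]
    refine Finset.sum_congr rfl fun k _ => Finset.sum_congr rfl fun l _ => ?_
    ring

theorem isHermitian_formMatrix_iff (e : Module.Basis m ℂ V) {s : V →ₗ[ℂ] V →ₗ⋆[ℂ] ℂ} :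
    (formMatrix e s).IsHermitian ↔ ∀ a b, s b a = star (s a b) := by
  constructor
  · intro h a b
    rw [form_eq_sum e s, form_eq_sum e s, star_sum, Finset.sum_comm]
    refine Finset.sum_congr rfl fun i _ => ?_
    rw [star_sum]
    refine Finset.sum_congr rfl fun j _ => ?_
    rw [← h.apply j i]
    simp only [star_mul', star_star]
    ring
  · intro h
    ext i j
    exact (h (e j) (e i)).symm

theorem formMatrix_dotProduct (e : Module.Basis m ℂ V) (s : V →ₗ[ℂ] V →ₗ⋆[ℂ] ℂ) (a : V) :
    s a a = star (fun i => star (e.repr a i)) ⬝ᵥ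
      (formMatrix e s *ᵥ fun i => star (e.repr a i)) := by
  rw [form_eq_sum e s]
  simp only [dotProduct, Matrix.mulVec, Pi.star_apply, star_star, Finset.mul_sum]
  refine Finset.sum_congr rfl fun i _ => Finset.sum_congr rfl fun j _ => ?_
  ring

theorem posDef_formMatrix_iff (e : Module.Basis m ℂ V) {s : V →ₗ[ℂ] V →ₗ⋆[ℂ] ℂ}
    (hs : ∀ a b, s b a = star (s a b)) :
    (formMatrix e s).PosDef ↔ ∀ a, a ≠ 0 → 0 < (s a a).re := by
  constructor
  · intro h a ha
    have h1 : (fun i => star (e.repr a i)) ≠ 0 := fun h0 => ha <| by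
      refine e.repr.map_eq_zero_iff.1 (Finsupp.ext fun i => ?_)
      simpa using congrFun h0 i
    have h2 := h.dotProduct_mulVec_pos h1
    rw [← formMatrix_dotProduct, Complex.pos_iff] at h2
    exact h2.1
  · intro h
    refine Matrix.PosDef.of_dotProduct_mulVec_pos ((isHermitian_formMatrix_iff e).2 hs)
      fun x hx => ?_
    let a : V := e.equivFun.symm fun i => star (x i)
    have hax : (fun i => star (e.repr a i)) = x := by
      ext i
      have : e.repr a i = star (x i) := by
        rw [← e.equivFun_apply, LinearEquiv.apply_symm_apply]
      rw [this, star_star]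
    have ha : a ≠ 0 := fun h0 => hx <| by
      rw [← hax, h0]; ext i; simp
    have h1 := formMatrix_dotProduct e s a
    rw [hax] at h1
    rw [← h1, Complex.pos_iff]
    refine ⟨h a ha, ?_⟩
    have h2 := congrArg Complex.im (hs a a)
    simp only [Complex.star_def, Complex.conj_im] at h2
    linarith

/-- The complex conjugate of the matrix of an endomorphism. Forms are conjugate linear in the second
variable, so that an endomorphism acting there multiplies the matrix of the form by this one
(`formMatrix_compl₂`). -/
def conjMatrix (e : Module.Basis m ℂ V) : Module.End ℂ V →+* Matrix m m ℂ :=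
  ((starRingEnd ℂ).mapMatrix).comp (LinearMap.toMatrixAlgEquiv e : _ →+* _)

theorem trace_conjMatrix (e : Module.Basis m ℂ V) (A : Module.End ℂ V) :
    (conjMatrix e A).trace = star (LinearMap.trace ℂ V A) := by
  rw [LinearMap.trace_eq_matrix_trace ℂ e]
  simp [conjMatrix, Matrix.trace, LinearMap.toMatrixAlgEquiv, LinearMap.toMatrix_apply]

theorem formMatrix_compl₂ (e : Module.Basis m ℂ V) (s : V →ₗ[ℂ] V →ₗ⋆[ℂ] ℂ)
    (A : Module.End ℂ V) : formMatrix e (s.compl₂ A) = formMatrix e s * conjMatrix e A := by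
  ext i j
  change s (e i) (A (e j)) = _
  conv_lhs => rw [← e.sum_repr (A (e j))]
  simp [-Module.Basis.sum_repr, Matrix.mul_apply, formMatrix, conjMatrix,
    LinearMap.toMatrixAlgEquiv_apply, mul_comm]

theorem conjMatrix_raise [FiniteDimensional ℂ V] (e : Module.Basis m ℂ V)
    {h : V →ₗ[ℂ] V →ₗ⋆[ℂ] ℂ} (hh : ∀ a, a ≠ 0 → 0 < (h a a).re)
    (hP : (formMatrix e h).PosDef) (v : V →ₗ[ℂ] V →ₗ⋆[ℂ] ℂ) :
    conjMatrix e (raise h v) = (formMatrix e h)⁻¹ * formMatrix e v := by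
  have h1 : v = h.compl₂ (raise h v) := by
    ext a b; exact raise_spec hh v a b
  have h2 : formMatrix e v = formMatrix e h * conjMatrix e (raise h v) := by
    conv_lhs => rw [h1]
    exact formMatrix_compl₂ e h _
  rw [h2, Matrix.nonsing_inv_mul_cancel_left _ _ ((Matrix.isUnit_iff_isUnit_det _).1 hP.isUnit)]

theorem conjMatrix_endExp [FiniteDimensional ℂ V] (e : Module.Basis m ℂ V) (A : Module.End ℂ V) :
    conjMatrix e (endExp A) = NormedSpace.exp (conjMatrix e A) := by
  have h1 : ∀ X : Matrix m m ℂ, (starRingEnd ℂ).mapMatrix X = (Xᴴ)ᵀ := fun X => rfl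
  simp only [conjMatrix, RingHom.comp_apply, h1]
  rw [Matrix.exp_transpose, Matrix.exp_conjTranspose]
  congr 2
  exact endExp_basis e A

end FormMatrix

section FormExpMatrix

open scoped Matrix Matrix.Norms.Operator ComplexOrder

variable {V : Type*} [AddCommGroup V] [Module ℂ V] [FiniteDimensional ℂ V]
  {m : Type} [Fintype m] [DecidableEq m]

/-- The form `h(a, e^{h⁻¹ v} b)` has the matrix `H e^{H⁻¹ V}`. -/
theorem formMatrix_eq_formExp_iff (e : Module.Basis m ℂ V)
    {h : V →ₗ[ℂ] V →ₗ⋆[ℂ] ℂ} (hh : ∀ a, a ≠ 0 → 0 < (h a a).re)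
    (hP : (formMatrix e h).PosDef) (v w : V →ₗ[ℂ] V →ₗ⋆[ℂ] ℂ) :
    formMatrix e w = formExp (formMatrix e h) (formMatrix e v) ↔
      ∀ a b, w a b = h a (endExp (raise h v) b) := by
  have h1 : formMatrix e (h.compl₂ (endExp (raise h v))) =
      formExp (formMatrix e h) (formMatrix e v) := by
    rw [formMatrix_compl₂, conjMatrix_endExp, conjMatrix_raise e hh hP, formExp_eq]
  rw [← h1]
  constructor
  · intro h2 a b
    rw [formMatrix_injective e h2]
    rfl
  · intro h2
    congr 1
    ext a b
    exact h2 a b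

end FormExpMatrix

/-! ### The Gram matrices of a section and the topology of the space of sections -/

section Sections

open scoped Matrix Matrix.Norms.Operator ComplexOrder

variable {n : ℕ} {M : Type*} [TopologicalSpace M] [ChartedSpace (EuclideanSpace ℝ (Fin n)) M]
  {F : Type*} [NormedAddCommGroup F] [NormedSpace ℂ F] [FiniteDimensional ℂ F]
  {E : M → Type*} [TopologicalSpace (Bundle.TotalSpace F E)] [∀ x, TopologicalSpace (E x)]
  [∀ x, AddCommGroup (E x)] [∀ x, Module ℂ (E x)] [FiberBundle F E] [VectorBundle ℂ F E]

variable (F) in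
/-- The matrices of sesquilinear forms on the fibres of a bundle with model fibre `F`. -/
abbrev FormMat : Type :=
  Matrix (Fin (Module.finrank ℂ F)) (Fin (Module.finrank ℂ F)) ℂ

variable (F E) in
/-- The basis of `E x` that corresponds to the standard basis of `F` in the trivialization at
`x₀`. -/
def frame (x₀ x : M) (hx : x ∈ (trivializationAt F E x₀).baseSet) :
    Module.Basis (Fin (Module.finrank ℂ F)) ℂ (E x) :=
  (Module.finBasis ℂ F).map ((trivializationAt F E x₀).linearEquivAt ℂ x hx).symm

/-- The Gram matrix of a section in the frame at `x₀`. -/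
def gram (x₀ : M) (s : HermSection n F E) (x : M) : FormMat F :=
  Matrix.of fun i j =>
    coeffAt F E s.form x₀ (Module.finBasis ℂ F i) (Module.finBasis ℂ F j) x

theorem gram_eq (x₀ : M) (s : HermSection n F E) {x : M}
    (hx : x ∈ (trivializationAt F E x₀).baseSet) :
    gram x₀ s x = formMatrix (frame F E x₀ x hx) (s.form x) := by
  ext i j
  simp [gram, formMatrix, frame, coeffAt]

theorem mem_base (x : M) : x ∈ (trivializationAt F E x).baseSet :=
  FiberBundle.mem_baseSet_trivializationAt F E x

theorem base_mem_nhds (x : M) : (trivializationAt F E x).baseSet ∈ 𝓝 x :=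
  (trivializationAt F E x).open_baseSet.mem_nhds (mem_base x)

/-- The linear map that computes the value at the vectors with coordinates `a`, `b` from the
matrix of a form. -/
def coeffL (a b : F) : FormMat F →L[ℝ] ℂ :=
  LinearMap.toContinuousLinearMap
    { toFun := fun A => ∑ i, ∑ j, (Module.finBasis ℂ F).repr a i *
        star ((Module.finBasis ℂ F).repr b j) * A i j
      map_add' := fun A B => by simp [mul_add, Finset.sum_add_distrib]
      map_smul' := fun c A => by
        simp only [Matrix.smul_apply, Complex.real_smul, Finset.mul_sum, RingHom.id_apply]
        refine Finset.sum_congr rfl fun i _ => Finset.sum_congr rfl fun j _ => ?_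
        ring }

theorem coeffAt_eq (s : ∀ x, E x →ₗ[ℂ] E x →ₗ⋆[ℂ] ℂ) (x₀ : M) (a b : F) {x : M}
    (hx : x ∈ (trivializationAt F E x₀).baseSet) :
    coeffAt F E s x₀ a b x = coeffL a b (formMatrix (frame F E x₀ x hx) (s x)) := by
  rw [coeffAt, form_eq_sum (frame F E x₀ x hx)]
  have h : ∀ a : F, (frame F E x₀ x hx).repr ((trivializationAt F E x₀).symm x a) =
      (Module.finBasis ℂ F).repr a := fun a => by
    rw [← (trivializationAt F E x₀).linearEquivAt_symm_apply (R := ℂ) x hx]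
    simp only [frame, Module.Basis.map_repr, LinearEquiv.symm_symm, LinearEquiv.trans_apply,
      LinearEquiv.apply_symm_apply]
  rw [h, h]
  rfl

/-- A matrix as a function of its entries. -/
def ofEntries : ((Fin (Module.finrank ℂ F) × Fin (Module.finrank ℂ F)) → ℂ) →L[ℝ] FormMat F :=
  LinearMap.toContinuousLinearMap
    { toFun := fun f => Matrix.of fun i j => f (i, j)
      map_add' := fun _ _ => rfl
      map_smul' := fun _ _ => rfl }

theorem contMDiffOn_gram (x₀ : M) (s : HermSection n F E) :
    ContMDiffOn (𝓡 n) 𝓘(ℝ, (Fin (Module.finrank ℂ F) × Fin (Module.finrank ℂ F)) → ℂ) ∞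
      (fun (x : M) (p : Fin (Module.finrank ℂ F) × Fin (Module.finrank ℂ F)) =>
        gram x₀ s x p.1 p.2) (trivializationAt F E x₀).baseSet :=
  contMDiffOn_pi_space.2 fun p => s.2.2 x₀ _ _

theorem HermSection.ext_gram {s t : HermSection n F E} (h : ∀ x, gram x s x = gram x t x) :
    s = t := by
  refine Subtype.ext (funext fun x => ?_)
  have := h x
  rw [gram_eq x s (mem_base x), gram_eq x t (mem_base x)] at this
  exact formMatrix_injective _ this

theorem gram_sub (x₀ x : M) (s t : HermSection n F E) :
    gram x₀ (s - t) x = gram x₀ s x - gram x₀ t x := rfl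

theorem gram_smul (x₀ x : M) (c : ℝ) (s : HermSection n F E) :
    gram x₀ (c • s) x = c • gram x₀ s x := rfl

theorem isHermitian_gram (s : HermSection n F E) {x₀ x : M}
    (hx : x ∈ (trivializationAt F E x₀).baseSet) : (gram x₀ s x).IsHermitian := by
  rw [gram_eq x₀ s hx]
  exact (isHermitian_formMatrix_iff _).2 (s.2.1 x)

theorem posDef_gram {h : HermSection n F E} (hh : h ∈ hermMetrics n F E) {x₀ x : M}
    (hx : x ∈ (trivializationAt F E x₀).baseSet) : (gram x₀ h x).PosDef := by
  rw [gram_eq x₀ h hx]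
  exact (posDef_formMatrix_iff _ (h.2.1 x)).2 (hh x)

theorem mem_hermMetrics_of_posDef {h : HermSection n F E}
    (hh : ∀ x, ∃ x₀, x ∈ (trivializationAt F E x₀).baseSet ∧ (gram x₀ h x).PosDef) :
    h ∈ hermMetrics n F E := by
  intro x
  obtain ⟨x₀, hx, hp⟩ := hh x
  rw [gram_eq x₀ h hx] at hp
  exact (posDef_formMatrix_iff _ (h.2.1 x)).1 hp

/-- Smooth Hermitian matrix functions in the frames, related by the changes of frame, are the Gram
matrices of a section. -/
theorem exists_section_of_gram (A : M → M → FormMat F)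
    (hA : ∀ (x x₀ x₁ : M) (h₀ : x ∈ (trivializationAt F E x₀).baseSet)
      (h₁ : x ∈ (trivializationAt F E x₁).baseSet) (P : FormMat F), IsUnit P →
      (∀ t, formMatrix (frame F E x₀ x h₀) t = P * formMatrix (frame F E x₁ x h₁) t * Pᴴ) →
      A x₀ x = P * A x₁ x * Pᴴ)
    (hherm : ∀ x, (A x x).IsHermitian)
    (hsmooth : ∀ x₀ i j, ContMDiffOn (𝓡 n) 𝓘(ℝ, ℂ) ∞ (fun x => A x₀ x i j)
      (trivializationAt F E x₀).baseSet) :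
    ∃ s : HermSection n F E, ∀ x₀, ∀ x ∈ (trivializationAt F E x₀).baseSet,
      gram x₀ s x = A x₀ x := by
  let f : ∀ x, E x →ₗ[ℂ] E x →ₗ⋆[ℂ] ℂ := fun x => formOfMatrix (frame F E x x (mem_base x)) (A x x)
  have hf : ∀ x₀ x (hx : x ∈ (trivializationAt F E x₀).baseSet),
      formMatrix (frame F E x₀ x hx) (f x) = A x₀ x := by
    intro x₀ x hx
    obtain ⟨P, hP, hPt⟩ := exists_congruence (frame F E x₀ x hx) (frame F E x x (mem_base x))
    rw [hPt, formMatrix_formOfMatrix, hA x x₀ x hx (mem_base x) P hP hPt]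
  refine ⟨⟨f, fun x => ?_, fun x₀ a b => ?_⟩, fun x₀ x hx => ?_⟩
  · refine (isHermitian_formMatrix_iff (frame F E x x (mem_base x))).1 ?_
    rw [hf]
    exact hherm x
  · refine ((coeffL a b ∘L ofEntries).contMDiff.comp_contMDiffOn (contMDiffOn_pi_space.2
      fun p : Fin (Module.finrank ℂ F) × Fin (Module.finrank ℂ F) =>
        hsmooth x₀ p.1 p.2)).congr fun x hx => ?_
    rw [coeffAt_eq f x₀ a b hx, hf]
    rfl
  · exact (gram_eq x₀ _ hx).trans (hf x₀ x hx)

/-- A natural operation on pairs of sesquilinear forms, expressed by matrices: a smooth map on an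
open set of pairs that is compatible with changes of frame and with `X ↦ Xᴴ`. -/
structure IsNaturalOp (O : Set (FormMat F × FormMat F)) (Φ : FormMat F × FormMat F → FormMat F) :
    Prop where
  isOpen : IsOpen O
  contDiffOn : ContDiffOn ℝ ∞ Φ O
  mapsTo : ∀ T : FormMat F →L[ℝ] FormMat F, IsFormSymmetry T → ∀ z ∈ O, (T z.1, T z.2) ∈ O
  symmetry : ∀ T : FormMat F →L[ℝ] FormMat F, IsFormSymmetry T → ∀ z ∈ O,
    Φ (T z.1, T z.2) = T (Φ z)

/-- A natural operation and its iterated derivatives act on sections. -/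
theorem IsNaturalOp.exists_section {O : Set (FormMat F × FormMat F)}
    {Φ : FormMat F × FormMat F → FormMat F} (hΦ : IsNaturalOp O Φ) {k : ℕ}
    (z : Fin k ⊕ Bool → HermSection n F E)
    (hz : ∀ x₀, ∀ x ∈ (trivializationAt F E x₀).baseSet,
      (gram x₀ (z (Sum.inr false)) x, gram x₀ (z (Sum.inr true)) x) ∈ O) :
    ∃ s : HermSection n F E, ∀ x₀, ∀ x ∈ (trivializationAt F E x₀).baseSet,
      gram x₀ s x = iterOp Φ k fun i => gram x₀ (z i) x := by
  have hT : ∀ T : FormMat F →L[ℝ] FormMat F, IsFormSymmetry T → ∀ x₀,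
      ∀ x ∈ (trivializationAt F E x₀).baseSet,
      iterOp Φ k (fun i => T (gram x₀ (z i) x)) = T (iterOp Φ k fun i => gram x₀ (z i) x) :=
    fun T hT x₀ x hx => iterOp_symmetry hΦ.isOpen hΦ.contDiffOn (hΦ.mapsTo T hT)
      (hΦ.symmetry T hT) k (hz x₀ x hx)
  refine exists_section_of_gram (fun x₀ x => iterOp Φ k fun i => gram x₀ (z i) x) ?_ ?_ ?_
  · intro x x₀ x₁ h₀ h₁ P hP hPt
    refine Eq.trans ?_ (hT (congruence P) (isFormSymmetry_congruence hP) x₁ x h₁)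
    congr 1
    ext1 i
    rw [gram_eq x₀ _ h₀, gram_eq x₁ _ h₁, hPt]
    rfl
  · intro x
    refine Eq.trans (hT conjTransposeL isFormSymmetry_conjTransposeL x x (mem_base x)).symm ?_
    congr 1
    ext1 i
    exact isHermitian_gram (z i) (mem_base x)
  · intro x₀ a b
    let L : ((Fin k ⊕ Bool) → (Fin (Module.finrank ℂ F) × Fin (Module.finrank ℂ F)) → ℂ) →L[ℝ]
        ((Fin k ⊕ Bool) → FormMat F) :=
      ContinuousLinearMap.pi fun i => ofEntries ∘L ContinuousLinearMap.proj i
    let D : FormMat F →L[ℝ] ℂ := LinearMap.toContinuousLinearMap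
      { toFun := fun X => X a b
        map_add' := fun _ _ => rfl
        map_smul' := fun _ _ => rfl }
    have h1 : ContDiffOn ℝ ∞ (fun w => D (iterOp Φ k (L w))) (L ⁻¹' opDomain O k) :=
      D.contDiff.comp_contDiffOn ((contDiffOn_iterOp hΦ.isOpen hΦ.contDiffOn k).comp
        L.contDiff.contDiffOn fun w hw => hw)
    have h2 : ContMDiffOn (𝓡 n) 𝓘(ℝ, (Fin k ⊕ Bool) →
        (Fin (Module.finrank ℂ F) × Fin (Module.finrank ℂ F)) → ℂ) ∞
        (fun (x : M) (i : Fin k ⊕ Bool) (p : Fin (Module.finrank ℂ F) × Fin (Module.finrank ℂ F)) =>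
          gram x₀ (z i) x p.1 p.2) (trivializationAt F E x₀).baseSet :=
      contMDiffOn_pi_space.2 fun i => contMDiffOn_gram x₀ (z i)
    have h3 : Set.MapsTo (fun (x : M) (i : Fin k ⊕ Bool)
        (p : Fin (Module.finrank ℂ F) × Fin (Module.finrank ℂ F)) => gram x₀ (z i) x p.1 p.2)
        (trivializationAt F E x₀).baseSet (L ⁻¹' opDomain O k) := fun x hx => hz x₀ x hx
    exact (contMDiffOn_iff_contDiffOn.2 h1).comp h2 h3

/-- The Gram matrix in the chart at `x₀`. -/
def localGram (x₀ : M) (s : HermSection n F E) (y : EuclideanSpace ℝ (Fin n)) : FormMat F :=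
  gram x₀ s ((chartAt (EuclideanSpace ℝ (Fin n)) x₀).symm y)

variable (n F E) in
theorem isOpen_localDomain (x₀ : M) : IsOpen (localDomain n F E x₀) :=
  (chartAt (EuclideanSpace ℝ (Fin n)) x₀).isOpen_inter_preimage_symm
    (trivializationAt F E x₀).open_baseSet

theorem contDiffOn_localGram [IsManifold (𝓡 n) ∞ M] (x₀ : M) (s : HermSection n F E) :
    ContDiffOn ℝ ∞ (localGram x₀ s) (localDomain n F E x₀) := by
  have h1 : ContDiffOn ℝ ∞ (fun y (p : Fin (Module.finrank ℂ F) × Fin (Module.finrank ℂ F)) =>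
      localGram x₀ s y p.1 p.2) (localDomain n F E x₀) := by
    rw [← contMDiffOn_iff_contDiffOn]
    exact (contMDiffOn_gram x₀ s).comp ((contMDiffOn_chart_symm (I := 𝓡 n) (n := ∞)
      (x := x₀)).mono Set.inter_subset_left) fun y hy => hy.2
  exact (ofEntries (F := F)).contDiff.comp_contDiffOn h1

theorem localCoeff_eqOn (x₀ : M) (a b : F) (s : HermSection n F E) :
    Set.EqOn (localCoeff n F E x₀ a b s) (fun y => coeffL a b (localGram x₀ s y))
      (localDomain n F E x₀) := fun y hy => by
  change coeffAt F E s.form x₀ a b _ = coeffL a b (gram x₀ s _)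
  rw [coeffAt_eq _ x₀ a b hy.2, gram_eq x₀ s hy.2]

/-- A family of sections converges in the smooth compact-open topology if and only if its Gram
matrices converge in `C^k` on the local domains, for all `k`. -/
theorem HermSection.tendsto_iff [IsManifold (𝓡 n) ∞ M] {ι : Type*} {l : Filter ι}
    {f : ι → HermSection n F E} {s : HermSection n F E} :
    Filter.Tendsto f l (𝓝 s) ↔ ∀ (x₀ : M) (k : ℕ), CkTendsto l (localDomain n F E x₀) k
      (fun p => localGram x₀ (f p)) (localGram x₀ s) := by
  have hsm : ∀ (x₀ : M) (a b : F) (s : HermSection n F E),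
      ContDiffOn ℝ ∞ (localCoeff n F E x₀ a b s) (localDomain n F E x₀) := fun x₀ a b s =>
    ((coeffL a b).contDiff.comp_contDiffOn (contDiffOn_localGram x₀ s)).congr
      (localCoeff_eqOn x₀ a b s)
  have h1 : Filter.Tendsto f l (𝓝 s) ↔ ∀ (x₀ : M) (a b : F) (j : ℕ),
      TendstoLocallyUniformlyOn (fun p => iteratedFDeriv ℝ j (localCoeff n F E x₀ a b (f p)))
        (iteratedFDeriv ℝ j (localCoeff n F E x₀ a b s)) l (localDomain n F E x₀) := by
    simp only [nhds_iInf, Filter.tendsto_iInf, nhds_induced, Filter.tendsto_comap_iff]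
    refine forall₄_congr fun x₀ a b j => ?_
    rw [tendstoLocallyUniformlyOn_iff_forall_isCompact (isOpen_localDomain n F E x₀),
      UniformOnFun.tendsto_iff_tendstoUniformlyOn]
    exact ⟨fun h K hK hK' => h K ⟨hK', hK⟩, fun h K hK => h K hK.2 hK.1⟩
  have h2 : Filter.Tendsto f l (𝓝 s) ↔ ∀ (x₀ : M) (a b : F) (k : ℕ),
      CkTendsto l (localDomain n F E x₀) k (fun p => localCoeff n F E x₀ a b (f p))
        (localCoeff n F E x₀ a b s) := by
    rw [h1]
    refine forall₃_congr fun x₀ a b => ?_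
    have hΩ := isOpen_localDomain n F E x₀
    simp only [ckTendsto_iff_iteratedFDeriv hΩ (fun p => hsm x₀ a b (f p)) (hsm x₀ a b s)]
    refine Iff.trans (forall_congr' fun j => tendstoLocallyUniformlyOn_iff_tendsto_prod hΩ ?_)
      ⟨fun h k j _ => h j, fun h j => h j j le_rfl⟩
    exact ((hsm x₀ a b s).continuousOn_iteratedFDerivWithin (m := j)
      (by exact_mod_cast le_top) (hΩ.uniqueDiffOn (𝕜 := ℝ))).congr
        fun y hy => (iteratedFDerivWithin_of_isOpen j hΩ hy).symm
  rw [h2]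
  constructor
  · intro h x₀ k
    have hΩ := isOpen_localDomain n F E x₀
    exact (CkTendsto.pi hΩ (σ := Fin (Module.finrank ℂ F) × Fin (Module.finrank ℂ F))
      fun p => h x₀ (Module.finBasis ℂ F p.1) (Module.finBasis ℂ F p.2) k).clm_comp hΩ
        (ofEntries (F := F))
  · intro h x₀ a b k
    have hΩ := isOpen_localDomain n F E x₀
    exact ((h x₀ k).clm_comp hΩ (coeffL a b)).congr hΩ
      (.of_forall fun p => (localCoeff_eqOn x₀ a b (f p)).symm) (localCoeff_eqOn x₀ a b s).symm

/-- Convergence of sections implies convergence of the Gram matrices, with moving base point. -/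
theorem HermSection.tendsto_gram [IsManifold (𝓡 n) ∞ M] {ι : Type*} {l : Filter ι}
    {f : ι → HermSection n F E} {s : HermSection n F E} (h : Filter.Tendsto f l (𝓝 s)) (x₀ : M) :
    Filter.Tendsto (fun q : ι × M => gram x₀ (f q.1) q.2) (l ×ˢ 𝓝 x₀) (𝓝 (gram x₀ s x₀)) := by
  set φ := chartAt (EuclideanSpace ℝ (Fin n)) x₀
  have hx : x₀ ∈ φ.source := mem_chart_source _ x₀
  have hy : φ x₀ ∈ localDomain n F E x₀ := by
    refine ⟨φ.map_source hx, ?_⟩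
    change φ.symm (φ x₀) ∈ (trivializationAt F E x₀).baseSet
    rw [φ.left_inv hx]
    exact mem_base x₀
  have h1 := (HermSection.tendsto_iff.1 h x₀ 0).tendsto hy
  have h2 : Filter.Tendsto (fun q : ι × M => (q.1, φ q.2)) (l ×ˢ 𝓝 x₀) (l ×ˢ 𝓝 (φ x₀)) :=
    Filter.tendsto_id.prodMap (φ.continuousAt hx)
  have h3 := h1.comp h2
  have h4 : localGram x₀ s (φ x₀) = gram x₀ s x₀ := by
    change gram x₀ s (φ.symm (φ x₀)) = _
    rw [φ.left_inv hx]
  rw [h4] at h3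
  refine h3.congr' ?_
  filter_upwards [(Filter.Eventually.of_forall fun _ => trivial : ∀ᶠ _ : ι in l, True).prod_mk
    (φ.open_source.mem_nhds hx)] with q hq
  change gram x₀ (f q.1) (φ.symm (φ q.2)) = _
  rw [φ.left_inv hq.2]

theorem HermSection.tendsto_gram_self [IsManifold (𝓡 n) ∞ M] {ι : Type*} {l : Filter ι}
    {f : ι → HermSection n F E} {s : HermSection n F E} (h : Filter.Tendsto f l (𝓝 s)) (x : M) :
    Filter.Tendsto (fun p => gram x (f p) x) l (𝓝 (gram x s x)) := by
  have h1 : Filter.Tendsto (fun p => (p, x)) l (l ×ˢ 𝓝 x) :=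
    Filter.tendsto_id.prodMk tendsto_const_nhds
  have h2 := (HermSection.tendsto_gram h x).comp h1
  simp only [Function.comp_def] at h2
  exact h2

end Sections

/-! ### Natural operations on sections are smooth -/

theorem CkTendsto.refl {ι : Type*} {E Z : Type} [NormedAddCommGroup E] [NormedSpace ℝ E]
    [NormedAddCommGroup Z] [NormedSpace ℝ Z] {l : Filter ι} {Ω : Set E} (hΩ : IsOpen Ω)
    {g : E → Z} (hg : ContDiffOn ℝ ∞ g Ω) (k : ℕ) : CkTendsto l Ω k (fun _ => g) g := by
  refine (ckTendsto_iff_iteratedFDeriv hΩ (fun _ => hg) hg k).2 fun j _ y hy => ?_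
  have h1 : ContinuousOn (iteratedFDeriv ℝ j g) Ω :=
    (hg.continuousOn_iteratedFDerivWithin (m := j) (by exact_mod_cast le_top)
      (hΩ.uniqueDiffOn (𝕜 := ℝ))).congr
        fun y hy => (iteratedFDerivWithin_of_isOpen j hΩ hy).symm
  exact ((h1.continuousAt (hΩ.mem_nhds hy)).tendsto).comp Filter.tendsto_snd

section NaturalOperations

open scoped Matrix Matrix.Norms.Operator ComplexOrder

/-- Positive definiteness persists under small perturbations by Hermitian matrices, by compactness of
the unit sphere. -/
theorem Matrix.PosDef.eventually {m : Type} [Fintype m] [DecidableEq m] {H : Matrix m m ℂ}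
    (hH : H.PosDef) : ∀ᶠ X in 𝓝 H, X.IsHermitian → X.PosDef := by
  have h1 : ∀ᶠ X in 𝓝 H, ∀ z ∈ Metric.sphere (0 : m → ℂ) 1, 0 < (star z ⬝ᵥ (X *ᵥ z)).re := by
    refine (isCompact_sphere (0 : m → ℂ) 1).eventually_forall_of_forall_eventually fun z hz => ?_
    have hz0 : z ≠ 0 := fun h0 => by simp [h0] at hz
    have hc : Continuous fun p : Matrix m m ℂ × (m → ℂ) => (star p.2 ⬝ᵥ (p.1 *ᵥ p.2)).re := by
      fun_prop
    exact (hc.tendsto (H, z)).eventually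
      (lt_mem_nhds (Complex.pos_iff.1 (hH.dotProduct_mulVec_pos hz0)).1)
  filter_upwards [h1] with X hX hherm
  refine Matrix.PosDef.of_dotProduct_mulVec_pos hherm fun x hx => ?_
  have hn : 0 < ‖x‖ := norm_pos_iff.2 hx
  have h2 := hX ((‖x‖⁻¹ : ℝ) • x) (by simp [norm_smul, hn.ne'])
  have h3 : star ((‖x‖⁻¹ : ℝ) • x) ⬝ᵥ (X *ᵥ ((‖x‖⁻¹ : ℝ) • x)) =
      ((‖x‖⁻¹ * ‖x‖⁻¹ : ℝ) : ℂ) * (star x ⬝ᵥ (X *ᵥ x)) := by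
    rw [Matrix.mulVec_smul, dotProduct_smul, star_smul, smul_dotProduct, smul_smul,
      Complex.real_smul]
    rfl
  rw [h3, Complex.re_ofReal_mul] at h2
  rw [Complex.pos_iff]
  refine ⟨pos_of_mul_pos_right h2 (by positivity), ?_⟩
  exact (hherm.im_star_dotProduct_mulVec_self x).symm

variable {n : ℕ} {M : Type*} [TopologicalSpace M] [ChartedSpace (EuclideanSpace ℝ (Fin n)) M]
  [IsManifold (𝓡 n) ∞ M]
  {F : Type*} [NormedAddCommGroup F] [NormedSpace ℂ F] [FiniteDimensional ℂ F]
  {E : M → Type*} [TopologicalSpace (Bundle.TotalSpace F E)] [∀ x, TopologicalSpace (E x)]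
  [∀ x, AddCommGroup (E x)] [∀ x, Module ℂ (E x)] [FiberBundle F E] [VectorBundle ℂ F E]

variable (n F E) in
/-- Positive definiteness is an open condition, by compactness of `M`. -/
theorem isOpen_hermMetrics [CompactSpace M] : IsOpen (hermMetrics n F E) := by
  rw [isOpen_iff_mem_nhds]
  intro h hh
  have h1 : ∀ᶠ s in 𝓝 h, ∀ x ∈ (Set.univ : Set M),
      ∃ x₀, x ∈ (trivializationAt F E x₀).baseSet ∧ (gram x₀ s x).PosDef := by
    refine isCompact_univ.eventually_forall_of_forall_eventually fun y _ => ?_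
    rw [nhds_prod_eq]
    have h2 := (HermSection.tendsto_gram (f := fun s : HermSection n F E => s) (l := 𝓝 h)
      Filter.tendsto_id y).eventually (posDef_gram hh (mem_base y)).eventually
    have h3 : ∀ᶠ q : HermSection n F E × M in 𝓝 h ×ˢ 𝓝 y,
        q.2 ∈ (trivializationAt F E y).baseSet :=
      Filter.tendsto_snd.eventually (base_mem_nhds y)
    filter_upwards [h2, h3] with q hq hq' using ⟨y, hq', hq (isHermitian_gram q.1 hq')⟩
  filter_upwards [h1] with s hs using mem_hermMetrics_of_posDef fun x => hs x trivial

/-- Lines are continuous for the smooth compact-open topology. -/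
theorem HermSection.tendsto_line (s w : HermSection n F E) (t₀ : ℝ) :
    Filter.Tendsto (fun t : ℝ => s + t • w) (𝓝 t₀) (𝓝 (s + t₀ • w)) := by
  refine HermSection.tendsto_iff.2 fun x₀ k => ?_
  have hΩ := isOpen_localDomain n F E x₀
  have h1 : CkTendsto (𝓝 t₀) (localDomain n F E x₀) k
      (fun t y => (t, localGram x₀ s y, localGram x₀ w y))
      (fun y => (t₀, localGram x₀ s y, localGram x₀ w y)) :=
    (CkTendsto.const k Filter.tendsto_id).prodMk hΩ
      ((CkTendsto.refl hΩ (contDiffOn_localGram x₀ s) k).prodMk hΩ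
        (CkTendsto.refl hΩ (contDiffOn_localGram x₀ w) k))
  have h2 : ContDiff ℝ ∞ (fun z : ℝ × FormMat F × FormMat F => z.2.1 + z.1 • z.2.2) := by
    fun_prop
  exact h1.comp_left hΩ isOpen_univ h2.contDiffOn (.of_forall fun _ _ _ => trivial)
    (fun _ _ => trivial)

/-- The arguments `(w_1, …, w_k; h, v)` of an iterated derivative, for the index type
`Fin k ⊕ Bool`. -/
def opArgs {S : Type*} {k : ℕ} (h v : S) (ws : Fin k → S) : Fin k ⊕ Bool → S :=
  Sum.elim ws fun c => cond c v h

theorem opArgs_snoc {S : Type*} {k : ℕ} (h v : S) (ws : Fin k → S) (w : S) (i : Fin k ⊕ Bool) :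
    opArgs h v (Fin.snoc ws w : Fin (k + 1) → S) (Sum.map Fin.castSucc id i) = opArgs h v ws i := by
  rcases i with i | i
  · simp [opArgs]
  · rfl

/-- The map on sections induced by a natural operation with first argument `h` is smooth: its
iterated derivatives are induced by the iterated derivatives of the operation. -/
theorem IsNaturalOp.bastianiSmoothOn {O : Set (FormMat F × FormMat F)}
    {Φ : FormMat F × FormMat F → FormMat F} (hΦ : IsNaturalOp O Φ) (h : HermSection n F E)
    {U : Set (HermSection n F E)} (hU : IsOpen U)
    (hUO : ∀ v ∈ U, ∀ x₀, ∀ x ∈ (trivializationAt F E x₀).baseSet,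
      (gram x₀ h x, gram x₀ v x) ∈ O)
    {f : HermSection n F E → HermSection n F E}
    (hf : ∀ v ∈ U, ∀ x, gram x (f v) x = Φ (gram x h x, gram x v x)) :
    BastianiSmoothOn f U := by
  classical
  have hex : ∀ (k : ℕ) (v : HermSection n F E) (ws : Fin k → HermSection n F E),
      ∃ s : HermSection n F E, v ∈ U → ∀ x₀, ∀ x ∈ (trivializationAt F E x₀).baseSet,
        gram x₀ s x = iterOp Φ k fun i => gram x₀ (opArgs h v ws i) x := by
    intro k v ws
    by_cases hv : v ∈ U
    · obtain ⟨s, hs⟩ := hΦ.exists_section (opArgs h v ws) (hUO v hv)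
      exact ⟨s, fun _ => hs⟩
    · exact ⟨0, fun hv' => absurd hv' hv⟩
  choose d hd using hex
  -- the arguments, in the chart at `x₀`
  let z : (k : ℕ) → M → HermSection n F E → (Fin k → HermSection n F E) →
      EuclideanSpace ℝ (Fin n) → (Fin k ⊕ Bool) → FormMat F :=
    fun k x₀ v ws y i => localGram x₀ (opArgs h v ws i) y
  have hzO : ∀ k x₀ v (ws : Fin k → HermSection n F E), v ∈ U →
      Set.MapsTo (z k x₀ v ws) (localDomain n F E x₀) (opDomain O k) :=
    fun k x₀ v ws hv y hy => hUO v hv x₀ _ hy.2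
  have hdz : ∀ k x₀ v (ws : Fin k → HermSection n F E), v ∈ U →
      Set.EqOn (localGram x₀ (d k v ws)) (fun y => iterOp Φ k (z k x₀ v ws y))
        (localDomain n F E x₀) :=
    fun k x₀ v ws hv y hy => hd k v ws hv x₀ _ hy.2
  refine ⟨d, fun v hv ws => ?_, fun k p hp => ?_, fun k v hv ws w => ?_⟩
  · refine HermSection.ext_gram fun x => ?_
    rw [hd 0 v ws hv x x (mem_base x), hf v hv]
    rfl
  · refine HermSection.tendsto_iff.2 fun x₀ j => ?_
    have hΩ := isOpen_localDomain n F E x₀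
    have harg : ∀ i, Filter.Tendsto
        (fun q : HermSection n F E × (Fin k → HermSection n F E) => opArgs h q.1 q.2 i)
        (𝓝[U ×ˢ Set.univ] p) (𝓝 (opArgs h p.1 p.2 i)) := by
      rintro (i | c)
      · exact (((continuous_apply i).comp continuous_snd).tendsto p).mono_left nhdsWithin_le_nhds
      · cases c
        · exact tendsto_const_nhds
        · exact (continuous_fst.tendsto p).mono_left nhdsWithin_le_nhds
    have hmem : ∀ᶠ q in 𝓝[U ×ˢ Set.univ] p, q.1 ∈ U :=
      (eventually_mem_nhdsWithin).mono fun q hq => hq.1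
    have h1 : CkTendsto (𝓝[U ×ˢ Set.univ] p) (localDomain n F E x₀) j
        (fun q => z k x₀ q.1 q.2) (z k x₀ p.1 p.2) :=
      (CkTendsto.pi (l := 𝓝[U ×ˢ Set.univ] p) (k := j) hΩ fun i : Fin k ⊕ Bool =>
        HermSection.tendsto_iff.1 (harg i) x₀ j)
    refine (h1.comp_left hΩ (isOpen_opDomain hΦ.isOpen k)
      (contDiffOn_iterOp hΦ.isOpen hΦ.contDiffOn k)
      (hmem.mono fun q hq => hzO k x₀ q.1 q.2 hq) (hzO k x₀ p.1 p.2 hp.1)).congr hΩ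
      (hmem.mono fun q hq => (hdz k x₀ q.1 q.2 hq).symm) (hdz k x₀ p.1 p.2 hp.1).symm
  · refine HermSection.tendsto_iff.2 fun x₀ j => ?_
    have hΩ := isOpen_localDomain n F E x₀
    have hmem : ∀ᶠ t in 𝓝[≠] (0 : ℝ), v + t • w ∈ U := by
      have h1 := HermSection.tendsto_line v w 0
      rw [zero_smul, add_zero] at h1
      exact (h1.mono_left nhdsWithin_le_nhds).eventually (hU.mem_nhds hv)
    let e : EuclideanSpace ℝ (Fin n) → (Fin k ⊕ Bool) → FormMat F :=
      fun y => Pi.single (Sum.inr true) (localGram x₀ w y)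
    have hline : ∀ (t : ℝ) y, z k x₀ v ws y + t • e y = z k x₀ (v + t • w) ws y := by
      intro t y
      ext1 i
      rcases i with i | c
      · simp [z, e, opArgs]
      · cases c
        · simp [z, e, opArgs]
        · simp only [z, e, opArgs, Pi.add_apply, Pi.smul_apply, Pi.single_eq_same, Sum.elim_inr,
            cond_true]
          rfl
    have hz : ContDiffOn ℝ ∞ (z k x₀ v ws) (localDomain n F E x₀) :=
      contDiffOn_pi.2 fun i => contDiffOn_localGram x₀ _
    have he : ContDiffOn ℝ ∞ e (localDomain n F E x₀) :=
      (ContinuousLinearMap.single ℝ (fun _ : Fin k ⊕ Bool => FormMat F)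
        (Sum.inr true)).contDiff.comp_contDiffOn (contDiffOn_localGram x₀ w)
    refine (CkTendsto.quotient hΩ (isOpen_opDomain hΦ.isOpen k)
      (contDiffOn_iterOp hΦ.isOpen hΦ.contDiffOn k) hz he (hzO k x₀ v ws hv)
      (hmem.mono fun t ht y hy => ?_) j).congr hΩ (hmem.mono fun t ht y hy => ?_) fun y hy => ?_
    · rw [hline]
      exact hzO k x₀ _ ws ht hy
    · beta_reduce
      rw [hline]
      have h1 := hdz k x₀ _ ws ht hy
      have h2 := hdz k x₀ v ws hv hy
      beta_reduce at h1 h2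
      rw [← h1, ← h2]
      rfl
    · have h1 := hdz (k + 1) x₀ v (Fin.snoc ws w) hv hy
      beta_reduce at h1 ⊢
      rw [h1, iterOp]
      congr 1
      · congr 1
        ext1 i
        simp only [z, opArgs_snoc]
      · simp [e, z, opArgs]

/-- Smoothness along a line: `t ↦ f(t v)`. -/
theorem BastianiSmoothOn.comp_smul {f : HermSection n F E → HermSection n F E}
    (hf : BastianiSmoothOn f Set.univ) (v : HermSection n F E) :
    BastianiSmoothOn (fun t : ℝ => f (t • v)) Set.univ := by
  obtain ⟨d, h0, hc, hd⟩ := hf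
  have hsmul : Continuous fun t : ℝ => t • v := by
    refine continuous_iff_continuousAt.2 fun t₀ => ?_
    have h1 := HermSection.tendsto_line 0 v t₀
    simp only [zero_add] at h1
    exact h1
  refine ⟨fun k t ws => d k (t • v) fun i => ws i • v, fun t _ w => h0 _ trivial _,
    fun k => ?_, fun k t _ ws w => ?_⟩
  · have h1 : Continuous fun p : HermSection n F E × (Fin k → HermSection n F E) =>
        d k p.1 p.2 := by
      rw [← continuousOn_univ, ← Set.univ_prod_univ]
      exact hc k
    have h2 : Continuous fun p : ℝ × (Fin k → ℝ) => (p.1 • v, fun i => p.2 i • v) :=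
      (hsmul.comp continuous_fst).prodMk
        (continuous_pi fun i => hsmul.comp ((continuous_apply i).comp continuous_snd))
    exact (h1.comp h2).continuousOn
  · have h1 := hd k (t • v) trivial (fun i => ws i • v) (w • v)
    have h2 : (Fin.snoc (fun i => ws i • v) (w • v) : Fin (k + 1) → HermSection n F E) =
        fun i => (Fin.snoc ws w : Fin (k + 1) → ℝ) i • v := by
      ext1 i
      refine Fin.lastCases ?_ (fun i => ?_) i <;> simp
    rw [h2] at h1
    refine Filter.Tendsto.congr (fun τ => ?_) h1
    rw [smul_smul, ← add_smul, smul_eq_mul]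

end NaturalOperations

/-! ### The map `v ↦ h e^{h⁻¹ v}` is a diffeomorphism -/

section ExponentialMap

open scoped Matrix Matrix.Norms.Operator ComplexOrder

variable {n : ℕ} {M : Type*} [TopologicalSpace M] [ChartedSpace (EuclideanSpace ℝ (Fin n)) M]
  {F : Type*} [NormedAddCommGroup F] [NormedSpace ℂ F] [FiniteDimensional ℂ F]
  {E : M → Type*} [TopologicalSpace (Bundle.TotalSpace F E)] [∀ x, TopologicalSpace (E x)]
  [∀ x, AddCommGroup (E x)] [∀ x, Module ℂ (E x)] [FiberBundle F E] [VectorBundle ℂ F E]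

variable (F) in
theorem isNaturalOp_formExp : IsNaturalOp (F := F) {z | IsUnit z.1} fun z => formExp z.1 z.2 where
  isOpen := Units.isOpen.preimage continuous_fst
  contDiffOn := contDiffOn_formExp
  mapsTo _ hT _ hz := hT.isUnit hz
  symmetry _ hT _ hz := formExp_symmetry hT hz _

variable (F) in
theorem isNaturalOp_formLog :
    IsNaturalOp (F := F) {z | InvertibleSegment z.1 z.2} fun z => formLog z.1 z.2 where
  isOpen := isOpen_invertibleSegment
  contDiffOn := contDiffOn_formLog
  mapsTo T hT z hz s hs := by
    have h1 : T z.1 + s • (T z.2 - T z.1) = T (z.1 + s • (z.2 - z.1)) := by simp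
    change IsUnit (T z.1 + s • (T z.2 - T z.1))
    rw [h1]
    exact hT.isUnit (hz s hs)
  symmetry _ hT _ hz := formLog_symmetry hT hz

theorem exists_hermExp {h : HermSection n F E} (hh : h ∈ hermMetrics n F E)
    (v : HermSection n F E) : ∃ s : HermSection n F E, ∀ x₀,
      ∀ x ∈ (trivializationAt F E x₀).baseSet,
        gram x₀ s x = formExp (gram x₀ h x) (gram x₀ v x) :=
  (isNaturalOp_formExp F).exists_section (k := 0) (opArgs h v Fin.elim0) fun _ _ hx =>
    (posDef_gram hh hx).isUnit

open Classical in
/-- The section `h e^{h⁻¹ v}`, for a metric `h`; the value at other `h` is arbitrary. -/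
def hermExp (h v : HermSection n F E) : HermSection n F E :=
  if hh : h ∈ hermMetrics n F E then (exists_hermExp hh v).choose else 0

theorem gram_hermExp {h : HermSection n F E} (hh : h ∈ hermMetrics n F E)
    (v : HermSection n F E) {x₀ x : M} (hx : x ∈ (trivializationAt F E x₀).baseSet) :
    gram x₀ (hermExp h v) x = formExp (gram x₀ h x) (gram x₀ v x) := by
  rw [hermExp, dif_pos hh]
  exact (exists_hermExp hh v).choose_spec x₀ x hx

theorem hermExp_zero {h : HermSection n F E} (hh : h ∈ hermMetrics n F E) :
    hermExp h 0 = h :=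
  HermSection.ext_gram fun x => by
    rw [gram_hermExp hh _ (mem_base x)]
    exact formExp_zero

theorem hermExp_form {h : HermSection n F E} (hh : h ∈ hermMetrics n F E)
    (v : HermSection n F E) (x : M) (a b : E x) :
    (hermExp h v).form x a b = h.form x a (fibreExp F (raise (h.form x) (v.form x)) b) := by
  have := finiteDimensional_fibre F E x
  have h1 := posDef_gram hh (mem_base x)
  have h2 := gram_hermExp hh v (mem_base x)
  rw [gram_eq x h (mem_base x)] at h1
  rw [gram_eq x _ (mem_base x), gram_eq x _ (mem_base x), gram_eq x _ (mem_base x)] at h2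
  exact (formMatrix_eq_formExp_iff _ (hh x) h1 _ _).1 h2 a b

theorem hermExp_mem {h : HermSection n F E} (hh : h ∈ hermMetrics n F E)
    (v : HermSection n F E) : hermExp h v ∈ hermMetrics n F E :=
  mem_hermMetrics_of_posDef fun x => ⟨x, mem_base x, by
    rw [gram_hermExp hh v (mem_base x)]
    exact posDef_formExp (posDef_gram hh (mem_base x)) (isHermitian_gram v (mem_base x))⟩

theorem bastianiSmoothOn_hermExp [IsManifold (𝓡 n) ∞ M] {h : HermSection n F E}
    (hh : h ∈ hermMetrics n F E) : BastianiSmoothOn (hermExp h) Set.univ :=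
  (isNaturalOp_formExp F).bastianiSmoothOn h isOpen_univ
    (fun _ _ _ _ hx => (posDef_gram hh hx).isUnit) fun v _ x => gram_hermExp hh v (mem_base x)

/-- The inverse of `v ↦ h e^{h⁻¹ v}` is `k ↦ h log(h⁻¹ k)`. -/
theorem isBastianiDiffeoOnto_hermExp [CompactSpace M] [IsManifold (𝓡 n) ∞ M]
    {h : HermSection n F E} (hh : h ∈ hermMetrics n F E) :
    IsBastianiDiffeoOnto (hermExp h) (hermMetrics n F E) := by
  classical
  have hlog : ∀ k : HermSection n F E, ∃ s : HermSection n F E, k ∈ hermMetrics n F E →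
      ∀ x, gram x s x = formLog (gram x h x) (gram x k x) := by
    intro k
    by_cases hk : k ∈ hermMetrics n F E
    · obtain ⟨s, hs⟩ := (isNaturalOp_formLog F).exists_section (k := 0) (opArgs h k Fin.elim0)
        fun _ _ hx => (posDef_gram hh hx).invertibleSegment (posDef_gram hk hx)
      exact ⟨s, fun _ x => hs x x (mem_base x)⟩
    · exact ⟨0, fun hk' => absurd hk' hk⟩
  choose g hg using hlog
  refine ⟨isOpen_hermMetrics n F E, hermExp_mem hh, bastianiSmoothOn_hermExp hh, g,
    fun v => ?_, fun k hk => ?_, ?_⟩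
  · refine HermSection.ext_gram fun x => ?_
    rw [hg _ (hermExp_mem hh v), gram_hermExp hh v (mem_base x),
      formLog_formExp (posDef_gram hh (mem_base x)) (isHermitian_gram v (mem_base x))]
  · refine HermSection.ext_gram fun x => ?_
    rw [gram_hermExp hh _ (mem_base x), hg k hk,
      formExp_formLog (posDef_gram hh (mem_base x)) (posDef_gram hk (mem_base x))]
  · exact (isNaturalOp_formLog F).bastianiSmoothOn h (isOpen_hermMetrics n F E)
      (fun k hk _ _ hx => (posDef_gram hh hx).invertibleSegment (posDef_gram hk hx))
      fun k hk x => hg k hk x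

end ExponentialMap

/-! ### The derivative of the integrand of the metric -/

section TraceDensity

universe u

variable {A : Type u} [NormedRing A] [NormedAlgebra ℝ A]

/-- The quadratic expression `Re (τ(H⁻¹ V H⁻¹ W) + a τ(H⁻¹ V) τ(H⁻¹ W))`; with the trace for `τ`
it is the integrand of the `L²` metric. -/
def traceDensity (τ : A →L[ℝ] ℂ) (a : ℝ) (H V W : A) : ℝ :=
  (τ (Ring.inverse H * V * (Ring.inverse H * W)) +
    (a : ℂ) * τ (Ring.inverse H * V) * τ (Ring.inverse H * W)).re

/-- The derivative of `traceDensity` in the direction `L` of the base point `H`. -/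
def traceDensityDeriv (τ : A →L[ℝ] ℂ) (a : ℝ) (H L V W : A) : ℝ :=
  -(τ (Ring.inverse H * L * (Ring.inverse H * V) * (Ring.inverse H * W)) +
    τ (Ring.inverse H * V * (Ring.inverse H * L * (Ring.inverse H * W))) +
    (a : ℂ) * τ (Ring.inverse H * L * (Ring.inverse H * V)) * τ (Ring.inverse H * W) +
    (a : ℂ) * τ (Ring.inverse H * V) * τ (Ring.inverse H * L * (Ring.inverse H * W))).re

/-- The pointwise form of the equation `b = v h⁻¹ v` for the metric spray. -/
theorem traceDensity_spray (τ : A →L[ℝ] ℂ) (hτ : ∀ X Y, τ (X * Y) = τ (Y * X)) (a : ℝ)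
    (H V L : A) : traceDensity τ a H (V * Ring.inverse H * V) L =
      traceDensityDeriv τ a H L V V / 2 - traceDensityDeriv τ a H V V L := by
  simp only [traceDensity, traceDensityDeriv]
  have h0 : Ring.inverse H * (V * Ring.inverse H * V) =
      Ring.inverse H * V * (Ring.inverse H * V) := by simp only [mul_assoc]
  rw [h0]
  generalize Ring.inverse H * V = X
  generalize Ring.inverse H * L = Y
  have h1 : τ (Y * X * X) = τ (X * X * Y) := by rw [mul_assoc, hτ]
  have h2 : τ (X * (Y * X)) = τ (X * X * Y) := by rw [hτ, mul_assoc, hτ]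
  have h3 : τ (Y * X) = τ (X * Y) := hτ _ _
  have h4 : τ (X * (X * Y)) = τ (X * X * Y) := by rw [mul_assoc]
  rw [h1, h2, h3, h4]
  simp only [mul_assoc, Complex.add_re, Complex.re_ofReal_mul, mul_comm (τ (X * Y))]
  ring

theorem traceDensity_sub (τ : A →L[ℝ] ℂ) (a : ℝ) (H V V' W : A) :
    traceDensity τ a H (V - V') W = traceDensity τ a H V W - traceDensity τ a H V' W := by
  simp only [traceDensity, mul_sub, sub_mul, map_sub, ← Complex.sub_re]
  congr 1
  ring

variable [CompleteSpace A]

theorem contDiffOn_traceDensity (τ : A →L[ℝ] ℂ) :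
    ContDiffOn ℝ ∞ (fun z : A × A × A × ℝ => traceDensity τ z.2.2.2 z.1 z.2.1 z.2.2.1)
      {z | IsUnit z.1} := by
  have hinv : ContDiffOn ℝ ∞ (fun z : A × A × A × ℝ => Ring.inverse z.1) {z | IsUnit z.1} :=
    contDiffOn_ringInverse.comp contDiff_fst.contDiffOn fun z hz => hz
  have h1 : ContDiffOn ℝ ∞ (fun z : A × A × A × ℝ => Ring.inverse z.1 * z.2.1)
      {z | IsUnit z.1} := hinv.mul (by fun_prop)
  have h2 : ContDiffOn ℝ ∞ (fun z : A × A × A × ℝ => Ring.inverse z.1 * z.2.2.1)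
      {z | IsUnit z.1} := hinv.mul (by fun_prop)
  have h3 : ContDiff ℝ ∞ (fun z : A × A × A × ℝ => (z.2.2.2 : ℂ)) :=
    Complex.ofRealCLM.contDiff.comp (by fun_prop)
  exact Complex.reCLM.contDiff.comp_contDiffOn ((τ.contDiff.comp_contDiffOn (h1.mul h2)).add
    ((h3.contDiffOn.mul (τ.contDiff.comp_contDiffOn h1)).mul (τ.contDiff.comp_contDiffOn h2)))

theorem hasDerivAt_traceDensity (τ : A →L[ℝ] ℂ) (a : ℝ) {H : A} (hH : IsUnit H) (L V W : A) :
    HasDerivAt (fun t : ℝ => traceDensity τ a (H + t • L) V W)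
      (traceDensityDeriv τ a H L V W) 0 := by
  have hP : HasDerivAt (fun t : ℝ => H + t • L) L 0 := by
    simpa using ((hasDerivAt_id (0 : ℝ)).smul_const L).const_add H
  have hQ := hP.ringInverse (by simpa using hH)
  simp only [zero_smul, add_zero] at hQ
  have hV := hQ.mul_const V
  have hW := hQ.mul_const W
  have h1 := τ.hasFDerivAt.comp_hasDerivAt (0 : ℝ) (hV.mul hW)
  have h2 := (τ.hasFDerivAt.comp_hasDerivAt (0 : ℝ) hV).const_mul (a : ℂ)
  have h3 := τ.hasFDerivAt.comp_hasDerivAt (0 : ℝ) hW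
  have h4 := Complex.reCLM.hasFDerivAt.comp_hasDerivAt (0 : ℝ) (h1.add (h2.mul h3))
  refine h4.congr_deriv ?_
  simp only [traceDensityDeriv, Function.comp_apply, zero_smul, add_zero, Complex.reCLM_apply,
    neg_mul, mul_neg, map_add, map_neg, mul_assoc, Complex.add_re]
  ring

theorem fderiv_traceDensity (τ : A →L[ℝ] ℂ) (a : ℝ) {H : A} (hH : IsUnit H) (L V W : A) :
    fderiv ℝ (fun z : A × A × A × ℝ => traceDensity τ z.2.2.2 z.1 z.2.1 z.2.2.1) (H, V, W, a)
      (L, 0, 0, 0) = traceDensityDeriv τ a H L V W := by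
  have hO : IsOpen {z : A × A × A × ℝ | IsUnit z.1} := Units.isOpen.preimage continuous_fst
  have h1 := (((contDiffOn_traceDensity τ).differentiableOn (by simp)).differentiableAt
    (hO.mem_nhds (x := (H, V, W, a)) hH)).hasFDerivAt
  have hl : HasDerivAt (fun t : ℝ => ((H, V, W, a) : A × A × A × ℝ) + t • (L, 0, 0, 0))
      (L, 0, 0, 0) 0 := by
    simpa using ((hasDerivAt_id (0 : ℝ)).smul_const
      ((L, 0, 0, 0) : A × A × A × ℝ)).const_add (H, V, W, a)
  have h2 := HasFDerivAt.comp_hasDerivAt (0 : ℝ) (by simpa using h1) hl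
  refine h2.unique ?_
  refine (hasDerivAt_traceDensity τ a hH L V W).congr_of_eventuallyEq (.of_forall fun t => ?_)
  simp

end TraceDensity

/-! ### The `L²` metric: nondegeneracy and metric spray -/

/-- A limit in the sense of continuous convergence is continuous. -/
theorem continuous_of_tendsto_prod {ι M Y : Type*} [TopologicalSpace M] [TopologicalSpace Y]
    [RegularSpace Y] {l : Filter ι} [l.NeBot] {Q : ι × M → Y} {q : M → Y}
    (h : ∀ x, Filter.Tendsto Q (l ×ˢ 𝓝 x) (𝓝 (q x))) : Continuous q := by
  refine continuous_iff_continuousAt.2 fun x₀ => ?_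
  refine ((closed_nhds_basis (q x₀)).tendsto_right_iff).2 fun B hB => ?_
  obtain ⟨P, hP, R, hR, hPR⟩ := Filter.eventually_prod_iff.1 ((h x₀).eventually hB.1)
  filter_upwards [eventually_eventually_nhds.2 hR] with x hx
  have h1 : Filter.Tendsto (fun i => Q (i, x)) l (𝓝 (q x)) :=
    (h x).comp (Filter.tendsto_id.prodMk tendsto_const_nhds)
  exact hB.2.mem_of_tendsto h1 (hP.mono fun i hi => hPR hi hx.self_of_nhds)

/-- Integrals over a compact space commute with locally uniform limits. -/
theorem tendsto_integral_of_tendsto_prod {M : Type*} [TopologicalSpace M] [CompactSpace M]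
    [MeasurableSpace M] [BorelSpace M] (μ : MeasureTheory.Measure M)
    [MeasureTheory.IsFiniteMeasure μ] {l : Filter ℝ} [l.IsCountablyGenerated] {Q : ℝ → M → ℝ}
    {q : M → ℝ} (hq : Continuous q) (hQ : ∀ᶠ t in l, Continuous (Q t))
    (h : ∀ x, Filter.Tendsto (fun p : ℝ × M => Q p.1 p.2) (l ×ˢ 𝓝 x) (𝓝 (q x))) :
    Filter.Tendsto (fun t => ∫ x, Q t x ∂μ) l (𝓝 (∫ x, q x ∂μ)) := by
  have h1 : TendstoUniformly Q q l := by
    rw [← tendstoLocallyUniformly_iff_tendstoUniformly_of_compactSpace,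
      ← tendstoLocallyUniformlyOn_univ]
    exact (tendstoLocallyUniformlyOn_iff_tendsto_prod isOpen_univ hq.continuousOn).2
      fun x _ => h x
  refine MeasureTheory.tendsto_integral_filter_of_dominated_convergence (fun x => ‖q x‖ + 1)
    ?_ ?_ ?_ ?_
  · exact hQ.mono fun t ht => ht.aestronglyMeasurable
  · filter_upwards [Metric.tendstoUniformly_iff.1 h1 1 one_pos] with t ht
    refine .of_forall fun x => ?_
    have h2 := ht x
    rw [dist_eq_norm, norm_sub_rev] at h2
    have h3 := norm_add_le (Q t x - q x) (q x)
    rw [sub_add_cancel] at h3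
    linarith
  · exact (hq.norm.integrable_of_hasCompactSupport (HasCompactSupport.of_compactSpace _)).add
      (MeasureTheory.integrable_const 1)
  · exact .of_forall fun x => h1.tendsto_at x

section L2Metric

open scoped Matrix Matrix.Norms.Operator ComplexOrder

variable {n : ℕ} {M : Type*} [TopologicalSpace M] [ChartedSpace (EuclideanSpace ℝ (Fin n)) M]
  {F : Type*} [NormedAddCommGroup F] [NormedSpace ℂ F] [FiniteDimensional ℂ F]
  {E : M → Type*} [TopologicalSpace (Bundle.TotalSpace F E)] [∀ x, TopologicalSpace (E x)]
  [∀ x, AddCommGroup (E x)] [∀ x, Module ℂ (E x)] [FiberBundle F E] [VectorBundle ℂ F E]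

variable (F) in
/-- The trace of matrices, as a real linear map. -/
def traceL : FormMat F →L[ℝ] ℂ :=
  LinearMap.toContinuousLinearMap
    { toFun := fun X => X.trace
      map_add' := Matrix.trace_add
      map_smul' := fun c X => Matrix.trace_smul c X }

theorem traceL_mul_comm (X Y : FormMat F) : traceL F (X * Y) = traceL F (Y * X) :=
  Matrix.trace_mul_comm X Y

/-- The integrand of the `L²` metric. -/
def l2Density (α : M → ℝ) (h v w : HermSection n F E) (x : M) : ℝ :=
  (LinearMap.trace ℂ (E x) (raise (h.form x) (v.form x) * raise (h.form x) (w.form x)) +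
    (α x : ℂ) * LinearMap.trace ℂ (E x) (raise (h.form x) (v.form x)) *
      LinearMap.trace ℂ (E x) (raise (h.form x) (w.form x))).re

theorem l2Metric_eq [MeasurableSpace M] (μ : MeasureTheory.Measure M) (α : M → ℝ)
    (h v w : HermSection n F E) : l2Metric μ α h v w = ∫ x, l2Density α h v w x ∂μ := rfl

theorem l2Density_eq (α : M → ℝ) {h : HermSection n F E} (hh : h ∈ hermMetrics n F E)
    (v w : HermSection n F E) {x₀ x : M} (hx : x ∈ (trivializationAt F E x₀).baseSet) :
    l2Density α h v w x =
      traceDensity (traceL F) (α x) (gram x₀ h x) (gram x₀ v x) (gram x₀ w x) := by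
  have := finiteDimensional_fibre F E x
  have hP := posDef_gram hh hx
  rw [gram_eq x₀ h hx] at hP
  have h1 : ∀ v : HermSection n F E, conjMatrix (frame F E x₀ x hx) (raise (h.form x) (v.form x)) =
      Ring.inverse (gram x₀ h x) * gram x₀ v x := fun v => by
    rw [conjMatrix_raise _ (hh x) hP, gram_eq x₀ h hx, gram_eq x₀ v hx,
      Matrix.nonsing_inv_eq_ringInverse]
  have h2 : ∀ (a : ℝ) (H V W : FormMat F), traceDensity (traceL F) a H V W =
      ((Ring.inverse H * V * (Ring.inverse H * W)).trace +
        (a : ℂ) * (Ring.inverse H * V).trace * (Ring.inverse H * W).trace).re :=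
    fun _ _ _ _ => rfl
  rw [h2, ← h1, ← h1, ← map_mul, trace_conjMatrix, trace_conjMatrix, trace_conjMatrix]
  unfold l2Density
  simp only [Complex.star_def, Complex.add_re, Complex.conj_re, mul_assoc, Complex.re_ofReal_mul,
    ← map_mul]

/-- The derivative of the integrand in the direction `l` of the base point, in the frame at the
point itself. -/
def l2DensityDeriv (α : M → ℝ) (h l v w : HermSection n F E) (x : M) : ℝ :=
  traceDensityDeriv (traceL F) (α x) (gram x h x) (gram x l x) (gram x v x) (gram x w x)

variable [IsManifold (𝓡 n) ∞ M]

theorem continuousAt_gram (x₀ : M) (s : HermSection n F E) : ContinuousAt (gram x₀ s) x₀ := by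
  have h1 := HermSection.tendsto_gram (l := (pure () : Filter Unit)) (f := fun _ => s)
    tendsto_const_nhds x₀
  have h2 : Filter.Tendsto (fun x : M => ((), x)) (𝓝 x₀) (pure () ×ˢ 𝓝 x₀) :=
    (Filter.tendsto_pure.2 (.of_forall fun _ => rfl)).prodMk Filter.tendsto_id
  have h3 := h1.comp h2
  simp only [Function.comp_def] at h3
  exact h3

theorem continuous_l2Density {α : M → ℝ} (hα : Continuous α) {h : HermSection n F E}
    (hh : h ∈ hermMetrics n F E) (v w : HermSection n F E) : Continuous (l2Density α h v w) := by
  refine continuous_iff_continuousAt.2 fun x₀ => ?_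
  have hO : IsOpen {z : FormMat F × FormMat F × FormMat F × ℝ | IsUnit z.1} :=
    Units.isOpen.preimage continuous_fst
  have h1 := ((contDiffOn_traceDensity (traceL F)).continuousOn.continuousAt (hO.mem_nhds
    (x := (gram x₀ h x₀, gram x₀ v x₀, gram x₀ w x₀, α x₀))
    (posDef_gram hh (mem_base x₀)).isUnit))
  have h2 : ContinuousAt (fun x => (gram x₀ h x, gram x₀ v x, gram x₀ w x, α x)) x₀ :=
    (continuousAt_gram x₀ h).prodMk ((continuousAt_gram x₀ v).prodMk
      ((continuousAt_gram x₀ w).prodMk hα.continuousAt))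
  refine (ContinuousAt.comp (f := fun x => (gram x₀ h x, gram x₀ v x, gram x₀ w x, α x))
    h1 h2).congr ?_
  filter_upwards [base_mem_nhds (F := F) (E := E) x₀] with x hx
  exact (l2Density_eq α hh v w hx).symm

theorem integrable_l2Density [CompactSpace M] [MeasurableSpace M] [BorelSpace M]
    (μ : MeasureTheory.Measure M) [MeasureTheory.IsFiniteMeasure μ] {α : M → ℝ}
    (hα : Continuous α) {h : HermSection n F E} (hh : h ∈ hermMetrics n F E)
    (v w : HermSection n F E) : MeasureTheory.Integrable (l2Density α h v w) μ :=
  (continuous_l2Density hα hh v w).integrable_of_hasCompactSupport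
    (HasCompactSupport.of_compactSpace _)

theorem eventually_mem_hermMetrics [CompactSpace M] {h : HermSection n F E}
    (hh : h ∈ hermMetrics n F E) (l : HermSection n F E) :
    ∀ᶠ t in 𝓝 (0 : ℝ), h + t • l ∈ hermMetrics n F E := by
  have h1 := HermSection.tendsto_line h l 0
  rw [zero_smul, add_zero] at h1
  exact h1.eventually ((isOpen_hermMetrics n F E).mem_nhds hh)

/-- The difference quotients of the integrand converge locally uniformly on `M`. -/
theorem tendsto_l2Density_quotient [CompactSpace M] {α : M → ℝ} (hα : Continuous α)
    {h : HermSection n F E} (hh : h ∈ hermMetrics n F E) (l v w : HermSection n F E) (x₀ : M) :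
    Filter.Tendsto (fun p : ℝ × M => p.1⁻¹ • (l2Density α (h + p.1 • l) v w p.2 -
      l2Density α h v w p.2)) (𝓝[≠] 0 ×ˢ 𝓝 x₀) (𝓝 (l2DensityDeriv α h l v w x₀)) := by
  have hu := (posDef_gram hh (mem_base x₀)).isUnit
  have hO : IsOpen {z : FormMat F × FormMat F × FormMat F × ℝ | IsUnit z.1} :=
    Units.isOpen.preimage continuous_fst
  have h1 := ((contDiffOn_traceDensity (traceL F)).contDiffAt (hO.mem_nhds
    (x := (gram x₀ h x₀, gram x₀ v x₀, gram x₀ w x₀, α x₀)) hu)).hasStrictFDerivAt (by simp)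
  have h2 : Filter.Tendsto (fun x => (gram x₀ h x, gram x₀ v x, gram x₀ w x, α x)) (𝓝 x₀)
      (𝓝 (gram x₀ h x₀, gram x₀ v x₀, gram x₀ w x₀, α x₀)) :=
    (continuousAt_gram x₀ h).tendsto.prodMk_nhds ((continuousAt_gram x₀ v).tendsto.prodMk_nhds
      ((continuousAt_gram x₀ w).tendsto.prodMk_nhds hα.continuousAt.tendsto))
  have h3 : Filter.Tendsto (fun x => ((gram x₀ l x, 0, 0, 0) :
      FormMat F × FormMat F × FormMat F × ℝ)) (𝓝 x₀) (𝓝 (gram x₀ l x₀, 0, 0, 0)) :=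
    (continuousAt_gram x₀ l).tendsto.prodMk_nhds tendsto_const_nhds
  have h4 := h1.tendsto_quotient (l := 𝓝[≠] (0 : ℝ) ×ˢ 𝓝 x₀) Filter.tendsto_fst
    (h2.comp Filter.tendsto_snd) (h3.comp Filter.tendsto_snd)
  have h5 := fderiv_traceDensity (traceL F) (α x₀) hu (gram x₀ l x₀) (gram x₀ v x₀)
    (gram x₀ w x₀)
  have h6 := Filter.Tendsto.mono_right h4 (le_of_eq (congrArg 𝓝 h5))
  refine Filter.Tendsto.congr' ?_ h6
  filter_upwards [((eventually_mem_hermMetrics hh l).filter_mono nhdsWithin_le_nhds).prod_mk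
    (base_mem_nhds (F := F) (E := E) x₀)] with p hp
  obtain ⟨hp1, hp2⟩ := hp
  rw [l2Density_eq α hp1 v w hp2, l2Density_eq α hh v w hp2]
  simp only [Function.comp_apply, Prod.smul_mk, smul_zero, Prod.mk_add_mk, add_zero]
  rfl

theorem continuous_l2DensityDeriv [CompactSpace M] {α : M → ℝ} (hα : Continuous α)
    {h : HermSection n F E} (hh : h ∈ hermMetrics n F E) (l v w : HermSection n F E) :
    Continuous (l2DensityDeriv α h l v w) :=
  continuous_of_tendsto_prod (tendsto_l2Density_quotient hα hh l v w)

theorem hasDirDeriv_l2Metric [CompactSpace M] [MeasurableSpace M] [BorelSpace M]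
    (μ : MeasureTheory.Measure M) [MeasureTheory.IsFiniteMeasure μ] {α : M → ℝ}
    (hα : Continuous α) {h : HermSection n F E} (hh : h ∈ hermMetrics n F E)
    (l v w : HermSection n F E) :
    HasDirDeriv (fun k => l2Metric μ α k v w) h l (∫ x, l2DensityDeriv α h l v w x ∂μ) := by
  have hev := (eventually_mem_hermMetrics hh l).filter_mono
    (nhdsWithin_le_nhds (s := {(0 : ℝ)}ᶜ))
  have h1 := tendsto_integral_of_tendsto_prod μ (l := 𝓝[≠] (0 : ℝ))
    (Q := fun t x => t⁻¹ • (l2Density α (h + t • l) v w x - l2Density α h v w x))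
    (continuous_l2DensityDeriv hα hh l v w)
    (hev.mono fun t ht => continuous_const.mul ((continuous_l2Density hα ht v w).sub
      (continuous_l2Density hα hh v w)))
    (tendsto_l2Density_quotient hα hh l v w)
  refine h1.congr' ?_
  filter_upwards [hev] with t ht
  rw [MeasureTheory.integral_smul, MeasureTheory.integral_sub (integrable_l2Density μ hα ht v w)
    (integrable_l2Density μ hα hh v w)]
  rfl

/-- The value of the metric spray is `v h⁻¹ v`. -/
theorem isSprayValue_of_gram [CompactSpace M] [MeasurableSpace M] [BorelSpace M]
    (μ : MeasureTheory.Measure M) [MeasureTheory.IsFiniteMeasure μ] {α : M → ℝ}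
    (hα : Continuous α) {h : HermSection n F E} (hh : h ∈ hermMetrics n F E)
    {v b : HermSection n F E}
    (hb : ∀ x, gram x b x = gram x v x * (gram x h x)⁻¹ * gram x v x) :
    IsSprayValue μ α h v b := by
  intro l
  refine ⟨_, _, hasDirDeriv_l2Metric μ hα hh l v v, hasDirDeriv_l2Metric μ hα hh v v l, ?_⟩
  have hint : ∀ l v w : HermSection n F E,
      MeasureTheory.Integrable (l2DensityDeriv α h l v w) μ := fun l v w =>
    (continuous_l2DensityDeriv hα hh l v w).integrable_of_hasCompactSupport
      (HasCompactSupport.of_compactSpace _)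
  rw [← MeasureTheory.integral_div, ← MeasureTheory.integral_sub ((hint l v v).div_const 2)
    (hint v v l), l2Metric_eq]
  congr 1
  ext1 x
  rw [l2Density_eq α hh b l (mem_base x), hb, Matrix.nonsing_inv_eq_ringInverse]
  exact traceDensity_spray _ traceL_mul_comm _ _ _ _

theorem l2Metric_sub_left [CompactSpace M] [MeasurableSpace M] [BorelSpace M]
    (μ : MeasureTheory.Measure M) [MeasureTheory.IsFiniteMeasure μ] {α : M → ℝ}
    (hα : Continuous α) {h : HermSection n F E} (hh : h ∈ hermMetrics n F E)
    (v v' w : HermSection n F E) :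
    l2Metric μ α h (v - v') w = l2Metric μ α h v w - l2Metric μ α h v' w := by
  simp only [l2Metric_eq]
  rw [← MeasureTheory.integral_sub (integrable_l2Density μ hα hh v w)
    (integrable_l2Density μ hα hh v' w)]
  congr 1
  ext1 x
  simp only [l2Density_eq α hh _ _ (mem_base x), gram_sub]
  exact traceDensity_sub _ _ _ _ _ _

/-- Nondegeneracy of the metric: the integrand of `(u, u)` is continuous and nonnegative, and it
vanishes only where `u` does (`trace_form_pos`). -/
theorem eq_zero_of_l2Metric_self [CompactSpace M] [MeasurableSpace M] [BorelSpace M]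
    (μ : MeasureTheory.Measure M) [MeasureTheory.IsFiniteMeasure μ] [μ.IsOpenPosMeasure]
    {α : M → ℝ} (hα : Continuous α) (hα' : ∀ x, -1 < (Module.finrank ℂ F : ℝ) * α x)
    {h : HermSection n F E} (hh : h ∈ hermMetrics n F E) {u : HermSection n F E}
    (hu : l2Metric μ α h u u = 0) : u = 0 := by
  have hpos := fun x => trace_form_pos (posDef_gram hh (mem_base x))
    (isHermitian_gram u (mem_base x)) (a := α x) (by simpa using hα' x)
  have heq : ∀ x, l2Density α h u u x = _ := fun x => l2Density_eq α hh u u (mem_base x)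
  simp only [traceDensity, ← Matrix.nonsing_inv_eq_ringInverse] at heq
  have h0 : 0 ≤ l2Density α h u u := fun x => by
    rw [heq]; exact (hpos x).1
  rw [l2Metric_eq, MeasureTheory.integral_eq_zero_iff_of_nonneg h0
    (integrable_l2Density μ hα hh u u)] at hu
  have h1 := ((continuous_l2Density hα hh u u).ae_eq_iff_eq μ continuous_zero).1 hu
  refine HermSection.ext_gram fun x => (hpos x).2 ?_
  refine (heq x).symm.trans (congrFun h1 x)

/-- The metric spray has at most one value, since the metric is nondegenerate. -/
theorem IsSprayValue.unique [CompactSpace M] [MeasurableSpace M] [BorelSpace M]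
    {μ : MeasureTheory.Measure M} [MeasureTheory.IsFiniteMeasure μ] [μ.IsOpenPosMeasure]
    {α : M → ℝ} (hα : Continuous α) (hα' : ∀ x, -1 < (Module.finrank ℂ F : ℝ) * α x)
    {h : HermSection n F E} (hh : h ∈ hermMetrics n F E) {v b b' : HermSection n F E}
    (hb : IsSprayValue μ α h v b) (hb' : IsSprayValue μ α h v b') : b = b' := by
  refine sub_eq_zero.1 (eq_zero_of_l2Metric_self μ hα hα' hh ?_)
  obtain ⟨p, q, hp, hq, h1⟩ := hb (b - b')
  obtain ⟨p', q', hp', hq', h2⟩ := hb' (b - b')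
  rw [l2Metric_sub_left μ hα hh, h1, h2, tendsto_nhds_unique hp hp', tendsto_nhds_unique hq hq',
    sub_self]

end L2Metric

/-! ### The geodesic equation of a fibre -/

section GeodesicODE

universe u

variable {A : Type u} [NormedRing A] [NormedAlgebra ℝ A]

variable [CompleteSpace A]

theorem hasDerivAt_formExp_smul (H V : A) (t : ℝ) :
    HasDerivAt (fun s : ℝ => formExp H (s • V)) (formExp H (t • V) * (Ring.inverse H * V)) t := by
  have h1 := (hasDerivAt_exp_smul_const (𝕂 := ℝ) (Ring.inverse H * V) t).const_mul H
  rw [← mul_assoc] at h1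
  simpa only [formExp, mul_smul_comm] using h1

/-- The equation `P'' = P' P⁻¹ P'` makes `P⁻¹ P'` constant, so that its solutions are the curves
`H e^{t H⁻¹ V}`. -/
theorem eq_formExp_of_hasDerivAt {P P₁ : ℝ → A} (hu : ∀ t, IsUnit (P t))
    (h1 : ∀ t, HasDerivAt P (P₁ t) t)
    (h2 : ∀ t, HasDerivAt P₁ (P₁ t * Ring.inverse (P t) * P₁ t) t) (t : ℝ) :
    P t = formExp (P 0) (t • P₁ 0) := by
  set X := Ring.inverse (P 0) * P₁ 0 with hX
  have hconst : ∀ {f : ℝ → A}, (∀ s, HasDerivAt f 0 s) → ∀ s, f s = f 0 := fun hf s =>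
    is_const_of_deriv_eq_zero (fun s => (hf s).differentiableAt) (fun s => (hf s).deriv) s 0
  have hP₁ : ∀ s, P₁ s = P s * X := fun s => by
    have h3 := hconst (f := fun s => Ring.inverse (P s) * P₁ s) (fun s => by
      refine (((h1 s).ringInverse (hu s)).mul (h2 s)).congr_deriv ?_
      simp only [neg_mul, mul_assoc]
      exact neg_add_cancel _) s
    rw [hX, ← h3, Ring.mul_inverse_cancel_left _ _ (hu s)]
  have h4 := hconst (f := fun s => P s * NormedSpace.exp (s • (-X))) (fun s => by
    refine ((h1 s).mul (hasDerivAt_exp_smul_const' (𝕂 := ℝ) (-X) s)).congr_deriv ?_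
    rw [hP₁ s]
    simp only [neg_mul, mul_neg, mul_assoc]
    exact add_neg_cancel _) t
  simp only [zero_smul, NormedSpace.exp_zero, mul_one] at h4
  let _ : NormedAlgebra ℚ A := NormedAlgebra.restrictScalars ℚ ℝ A
  have h5 : NormedSpace.exp (t • (-X)) * NormedSpace.exp (t • X) = 1 := by
    rw [← NormedSpace.exp_add_of_commute, smul_neg, neg_add_cancel, NormedSpace.exp_zero]
    rw [smul_neg]
    exact (Commute.refl _).neg_left
  rw [formExp, mul_smul_comm, ← hX, ← h4, mul_assoc, h5, mul_one]

end GeodesicODE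

/-! ### Existence and uniqueness of geodesics, and the exponential map -/

section Geodesic

open scoped Matrix Matrix.Norms.Operator ComplexOrder

variable {n : ℕ} {M : Type*} [TopologicalSpace M] [ChartedSpace (EuclideanSpace ℝ (Fin n)) M]
  [IsManifold (𝓡 n) ∞ M]
  {F : Type*} [NormedAddCommGroup F] [NormedSpace ℂ F] [FiniteDimensional ℂ F]
  {E : M → Type*} [TopologicalSpace (Bundle.TotalSpace F E)] [∀ x, TopologicalSpace (E x)]
  [∀ x, AddCommGroup (E x)] [∀ x, Module ℂ (E x)] [FiberBundle F E] [VectorBundle ℂ F E]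

theorem HasDirDeriv.hasDerivAt_gram {γ : ℝ → HermSection n F E} {t : ℝ} {d : HermSection n F E}
    (hd : HasDirDeriv γ t 1 d) (x : M) :
    HasDerivAt (fun s => gram x (γ s) x) (gram x d x) t := by
  refine hasDerivAt_iff_tendsto_slope_zero.2 ?_
  have h1 := HermSection.tendsto_gram_self hd x
  simp only [gram_smul, gram_sub, smul_eq_mul, mul_one] at h1
  exact h1

/-- The curve `γ(t) = h e^{t h⁻¹ v}` of sections satisfies `γ'(0) = v` and `γ'' = γ' γ⁻¹ γ'`: its
derivatives exist by `bastianiSmoothOn_hermExp`, and are computed in the frames, where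
`P(t) = H e^{t H⁻¹ V}` has `P' = P H⁻¹ V`. -/
theorem exists_derivatives_hermExp {h : HermSection n F E} (hh : h ∈ hermMetrics n F E)
    (v : HermSection n F E) : ∃ γ₁ γ₂ : ℝ → HermSection n F E,
      (∀ t, HasDirDeriv (fun s : ℝ => hermExp h (s • v)) t 1 (γ₁ t)) ∧
      (∀ t, HasDirDeriv γ₁ t 1 (γ₂ t)) ∧ γ₁ 0 = v ∧
      ∀ t x, gram x (γ₂ t) x =
        gram x (γ₁ t) x * (gram x (hermExp h (t • v)) x)⁻¹ * gram x (γ₁ t) x := by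
  obtain ⟨d, h0, -, hd⟩ := (bastianiSmoothOn_hermExp hh).comp_smul v
  have h1 : ∀ t, HasDirDeriv (fun s : ℝ => hermExp h (s • v)) t 1
      (d 1 t (Fin.snoc Fin.elim0 (1 : ℝ))) := fun t => by
    have h2 := hd 0 t trivial Fin.elim0 1
    simpa only [h0 _ (Set.mem_univ _)] using h2
  have h2 := fun t => hd 1 t trivial (Fin.snoc Fin.elim0 (1 : ℝ)) 1
  have hu : ∀ x : M, IsUnit (gram x h x) := fun x => (posDef_gram hh (mem_base x)).isUnit
  have hP : ∀ (t : ℝ) (x : M), gram x (hermExp h (t • v)) x =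
      formExp (gram x h x) (t • gram x v x) := fun t x => by
    rw [gram_hermExp hh _ (mem_base x), gram_smul]
  have hP₁ : ∀ (t : ℝ) (x : M), gram x (d 1 t (Fin.snoc Fin.elim0 (1 : ℝ))) x =
      formExp (gram x h x) (t • gram x v x) * (Ring.inverse (gram x h x) * gram x v x) :=
    fun t x => by
      have h3 := (h1 t).hasDerivAt_gram x
      simp only [hP] at h3
      exact h3.unique (hasDerivAt_formExp_smul _ _ t)
  refine ⟨_, _, h1, h2, HermSection.ext_gram fun x => ?_, fun t x => ?_⟩
  · rw [hP₁, zero_smul, formExp_zero, Ring.mul_inverse_cancel_left _ _ (hu x)]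
  · have h3 := (h2 t).hasDerivAt_gram x
    simp only [hP₁] at h3
    have h4 := h3.unique ((hasDerivAt_formExp_smul _ _ t).mul_const _)
    have h5 : IsUnit (formExp (gram x h x) (t • gram x v x)) := by
      rw [← hP]
      exact (posDef_gram (hermExp_mem hh _) (mem_base x)).isUnit
    rw [h4, hP₁, hP, Matrix.nonsing_inv_eq_ringInverse, mul_assoc (formExp _ _ * _),
      Ring.inverse_mul_cancel_left _ _ h5]

variable [CompactSpace M] [MeasurableSpace M] [BorelSpace M] {μ : MeasureTheory.Measure M}
  [MeasureTheory.IsFiniteMeasure μ] {α : M → ℝ}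

theorem isL2GeodesicFrom_hermExp (hα : Continuous α) {h : HermSection n F E}
    (hh : h ∈ hermMetrics n F E) (v : HermSection n F E) :
    IsL2GeodesicFrom μ α h v fun t => hermExp h (t • v) := by
  obtain ⟨γ₁, γ₂, h1, h2, h3, h4⟩ := exists_derivatives_hermExp hh v
  refine ⟨⟨fun t => hermExp_mem hh _, (bastianiSmoothOn_hermExp hh).comp_smul v, γ₁, γ₂, h1, h2,
    fun t => isSprayValue_of_gram μ hα (hermExp_mem hh _) (h4 t)⟩, ?_, ?_⟩
  · change hermExp h ((0 : ℝ) • v) = h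
    rw [zero_smul, hermExp_zero hh]
  · have h5 := h1 0
    rw [h3] at h5
    exact h5

/-- The only value of the metric spray is `v h⁻¹ v`. -/
theorem IsSprayValue.gram_eq [μ.IsOpenPosMeasure] (hα : Continuous α)
    (hα' : ∀ x, -1 < (Module.finrank ℂ F : ℝ) * α x) {h : HermSection n F E}
    (hh : h ∈ hermMetrics n F E) {v b : HermSection n F E} (hb : IsSprayValue μ α h v b) (x : M) :
    gram x b x = gram x v x * (gram x h x)⁻¹ * gram x v x := by
  -- the family `v h⁻¹ v` is a smooth section: the second derivative of `h e^{t h⁻¹ v}` at `t = 0`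
  obtain ⟨γ₁, γ₂, -, -, h3, h4⟩ := exists_derivatives_hermExp hh v
  have h5 := h4 0
  simp only [zero_smul, hermExp_zero hh, h3] at h5
  rw [hb.unique hα hα' hh (isSprayValue_of_gram μ hα hh h5), h5]

/-- Geodesics are unique, because their Gram matrices solve the geodesic equation of the fibre. -/
theorem IsL2GeodesicFrom.eq_hermExp [μ.IsOpenPosMeasure] (hα : Continuous α)
    (hα' : ∀ x, -1 < (Module.finrank ℂ F : ℝ) * α x) {h : HermSection n F E}
    (hh : h ∈ hermMetrics n F E) {v : HermSection n F E} {γ : ℝ → HermSection n F E}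
    (hγ : IsL2GeodesicFrom μ α h v γ) : γ = fun t => hermExp h (t • v) := by
  obtain ⟨⟨hmem, -, γ₁, γ₂, h1, h2, h3⟩, rfl, h5⟩ := hγ
  ext1 t
  refine HermSection.ext_gram fun x => ?_
  have h6 := eq_formExp_of_hasDerivAt (P := fun s => gram x (γ s) x)
    (P₁ := fun s => gram x (γ₁ s) x)
    (fun s => (posDef_gram (hmem s) (mem_base x)).isUnit) (fun s => (h1 s).hasDerivAt_gram x)
    (fun s => by
      have h7 := (h2 s).hasDerivAt_gram x
      rw [(h3 s).gram_eq hα hα' (hmem s), Matrix.nonsing_inv_eq_ringInverse] at h7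
      exact h7) t
  have h8 : gram x (γ₁ 0) x = gram x v x :=
    ((h1 0).hasDerivAt_gram x).unique (h5.hasDerivAt_gram x)
  rw [gram_hermExp hh _ (mem_base x), gram_smul, ← h8]
  exact h6

end Geodesic

end

theorem theorem3p8 {n : ℕ}
    {M : Type*} [TopologicalSpace M] [CompactSpace M] [T2Space M]
    [ChartedSpace (EuclideanSpace ℝ (Fin n)) M] [IsManifold (𝓡 n) ∞ M]
    {F : Type*} [NormedAddCommGroup F] [NormedSpace ℂ F] [FiniteDimensional ℂ F]
    {E : M → Type*} [TopologicalSpace (Bundle.TotalSpace F E)] [∀ x, TopologicalSpace (E x)]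
    [∀ x, AddCommGroup (E x)] [∀ x, Module ℂ (E x)] [FiberBundle F E] [VectorBundle ℂ F E]
    [ContMDiffVectorBundle ∞ F E (𝓡 n)]
    [MeasurableSpace M] [BorelSpace M] (μ : MeasureTheory.Measure M)
    [MeasureTheory.IsFiniteMeasure μ] [μ.IsOpenPosMeasure]
    (α : M → ℝ) (hα : ContMDiff (𝓡 n) 𝓘(ℝ, ℝ) ∞ α)
    (hα' : ∀ x, -1 < (Module.finrank ℂ F : ℝ) * α x)
    (h : HermSection n F E) (hh : h ∈ hermMetrics n F E) :
    (∀ v : HermSection n F E, ∃! γ : ℝ → HermSection n F E, IsL2GeodesicFrom μ α h v γ) ∧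
    (∀ (v : HermSection n F E) (x : M) (a b : E x),
      (Exp μ α h v).form x a b =
        h.form x a (fibreExp F (raise (h.form x) (v.form x)) b)) ∧
    IsBastianiDiffeoOnto (Exp μ α h) (hermMetrics n F E) := by
  have hexp : Exp μ α h = hermExp h := by
    ext1 v
    have h1 : IsL2GeodesicFrom μ α h v (Classical.epsilon (IsL2GeodesicFrom μ α h v)) :=
      Classical.epsilon_spec ⟨_, isL2GeodesicFrom_hermExp hα.continuous hh v⟩
    rw [Exp, h1.eq_hermExp hα.continuous hα' hh]
    exact congrArg (hermExp h) (one_smul ℝ v)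
  refine ⟨fun v => ⟨_, isL2GeodesicFrom_hermExp hα.continuous hh v, fun γ hγ =>
    hγ.eq_hermExp hα.continuous hα' hh⟩, fun v x a b => ?_, ?_⟩
  · rw [hexp]
    exact hermExp_form hh v x a b
  · rw [hexp]
    exact isBastianiDiffeoOnto_hermExp hh
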